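/- **Theorem 2.2** (regularity of weak solutions). Let $\ell,T>0$ and let $L^2$, $H^k$ denote the usual real Lebesgue and Sobolev spaces on intervals, with $\|f\|_{H^k}^2=\sum_{j=0}^{k}\|f^{(j)}\|_{L^2}^2$. Let $\mathcal V_1^2(0,\ell)=\{v\in H^2(0,\ell): v(0)=v_x(0)=0\}$, with the norm of $H^2(0,\ell)$. Suppose that $\rho,\mu\in L^\infty(0,\ell)$, $r,\kappa\in H^2(0,\ell)$ and that, for constants and a.e. $x\in(0,\ell)$, $$0<\rho_0\le\rho(x)\le\rho_1,\quad 0\le\mu_0\le\mu(x)\le\mu_1,\quad 0<r_0\le r(x)\le r_1,\quad 0<\kappa_0\le\kappa(x)\le\kappa_1.$$ Let $g\in H^2(0,T)$ with $g(0)=g'(0)=0$. Let $u$ be the weak solution of $$\rho u_{tt}+\mu u_t+(ru_{xx})_{xx}+(\kappa u_{xxt})_{xx}=0\ \text{ in }(0,\ell)\times(0,T),$$ $$u(\cdot,0)=u_t(\cdot,0)=0,\qquad u(0,t)=u_x(0,t)=0,$$ $$\left[ru_{xx}+\kappa u_{xxt}\right]_{x=\ell}=0,\qquad -\left[(ru_{xx}+\kappa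 u_{xxt})_x\right]_{x=\ell}=g(t),$$ that is, $u,u_t\in L^2(0,T;\mathcal V_1^2(0,\ell))$, $u_{tt}\in L^2(0,T;L^2(0,\ell))$, $u(0)=0$ and $u_t(0)=0$ (for the continuous representatives), and for every $v\in\mathcal V_1^2(0,\ell)$ and a.e. $t\in(0,T)$ $$\int_0^\ell\left(\rho u_{tt}(t)v+\mu u_t(t)v+ru_{xx}(t)v_{xx}+\kappa u_{xxt}(t)v_{xx}\right)dx=g(t)\,v(\ell).$$ Then $u\in H^1(0,T;H^4(0,\ell))$, $u_{tt}\in L^2(0,T;\mathcal V_1^2(0,\ell))$, $u_{ttt}\in L^2(0,T;L^2(0,\ell))$, and $$\|u_{ttt}\|^2_{L^2(0,T;L^2(0,\ell))}\le\frac{\kappa_0}{2}\cdot\frac{C_5^2}{2\rho_0}\,\exp(C_5^2T)\,\|g\|^2_{H^2(0,T)},$$ where $$C_5^2=\frac{2}{\kappa_0}\max\left(\frac{2(1+T)(\ell^3+3)}{3\kappa_0},\ \frac{\kappa_0\ell^3}{2(\ell^3+3)}+2r_1+\frac{2Tr_1^2(\ell^3+3)}{3\kappa_0}\right).$$ -/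

import Mathlib

open MeasureTheory Set
open scoped ContDiff

noncomputable section

/-- Lebesgue measure on the open interval `(a, b)`. -/
abbrev muIoo (a b : ℝ) : Measure ℝ := volume.restrict (Ioo a b)

/-- The Hilbert space `L²(a, b)` of real-valued functions. -/
abbrev L2 (a b : ℝ) : Type := Lp ℝ 2 (muIoo a b)

/-- `f'` is the weak (distributional) derivative of `f` on the open interval `(a, b)`; the
functions take values in a Banach space `E`, and the test functions are real-valued, smooth and
compactly supported in `(a, b)`. It is only used for functions that are square integrable on a
bounded interval. -/
def HasWeakDerivOn {E : Type*} [NormedAddCommGroup E] [NormedSpace ℝ E]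
    (a b : ℝ) (f f' : ℝ → E) : Prop :=
  ∀ φ : ℝ → ℝ, ContDiff ℝ ∞ φ → HasCompactSupport φ → tsupport φ ⊆ Ioo a b →
    ∫ t in Ioo a b, deriv φ t • f t = - ∫ t in Ioo a b, φ t • f' t

/-- The continuous representative on `[a, b]` of the (a.e. class of the) function `f` exists and
has value `c` at the point `x ∈ [a, b]`. -/
def HasValueAt {E : Type*} [NormedAddCommGroup E]
    (a b : ℝ) (f : ℝ → E) (x : ℝ) (c : E) : Prop :=
  ∃ F : ℝ → E, ContinuousOn F (Icc a b) ∧ F =ᵐ[muIoo a b] f ∧ F x = c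

theorem integrable_test_mul {a b : ℝ} {φ : ℝ → ℝ} (hφ : Continuous φ)
    (hs : HasCompactSupport φ) (f : L2 a b) :
    Integrable (fun t => φ t • f t) (muIoo a b) := by
  obtain ⟨C, hC⟩ := hs.exists_bound_of_continuous hφ
  have hf : Integrable (fun t => f t) (muIoo a b) :=
    (Lp.memLp f).integrable (by norm_num)
  exact hf.bdd_mul hφ.aestronglyMeasurable (Filter.Eventually.of_forall hC)

theorem integrable_deriv_test_mul {a b : ℝ} {φ : ℝ → ℝ} (hφ : ContDiff ℝ ∞ φ)
    (hs : HasCompactSupport φ) (f : L2 a b) :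
    Integrable (fun t => deriv φ t • f t) (muIoo a b) :=
  integrable_test_mul (hφ.continuous_deriv (by norm_num)) hs.deriv f

theorem HasWeakDerivOn.zero_L2 (a b : ℝ) :
    HasWeakDerivOn a b (⇑(0 : L2 a b)) (⇑(0 : L2 a b)) := by
  intro φ _ _ _
  have h0 := Lp.coeFn_zero ℝ 2 (muIoo a b)
  have key : ∀ ψ : ℝ → ℝ, ∫ t in Ioo a b, ψ t • (0 : L2 a b) t = 0 := by
    intro ψ
    refine integral_eq_zero_of_ae ?_
    filter_upwards [h0] with t ht
    change ψ t • (0 : L2 a b) t = 0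
    rw [ht, Pi.zero_apply, smul_zero]
  rw [key, key, neg_zero]

theorem HasWeakDerivOn.add_L2 {a b : ℝ} {f f' g g' : L2 a b}
    (hf : HasWeakDerivOn a b f f') (hg : HasWeakDerivOn a b g g') :
    HasWeakDerivOn a b (⇑(f + g)) (⇑(f' + g')) := by
  intro φ h1 h2 h3
  have e1 : ∫ t in Ioo a b, deriv φ t • (f + g) t
      = ∫ t in Ioo a b, (deriv φ t • f t + deriv φ t • g t) := by
    refine integral_congr_ae ?_
    filter_upwards [Lp.coeFn_add f g] with t ht
    rw [ht, Pi.add_apply, smul_add]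
  have e2 : ∫ t in Ioo a b, φ t • (f' + g') t
      = ∫ t in Ioo a b, (φ t • f' t + φ t • g' t) := by
    refine integral_congr_ae ?_
    filter_upwards [Lp.coeFn_add f' g'] with t ht
    rw [ht, Pi.add_apply, smul_add]
  rw [e1, e2, integral_add (integrable_deriv_test_mul h1 h2 f) (integrable_deriv_test_mul h1 h2 g),
    integral_add (integrable_test_mul h1.continuous h2 f') (integrable_test_mul h1.continuous h2 g'),
    hf φ h1 h2 h3, hg φ h1 h2 h3]
  ring

theorem HasWeakDerivOn.smul_L2 {a b : ℝ} (c : ℝ) {f f' : L2 a b}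
    (hf : HasWeakDerivOn a b f f') :
    HasWeakDerivOn a b (⇑(c • f)) (⇑(c • f')) := by
  intro φ h1 h2 h3
  have e1 : ∫ t in Ioo a b, deriv φ t • (c • f) t
      = ∫ t in Ioo a b, c • (deriv φ t • f t) := by
    refine integral_congr_ae ?_
    filter_upwards [Lp.coeFn_smul c f] with t ht
    rw [ht, Pi.smul_apply, smul_comm]
  have e2 : ∫ t in Ioo a b, φ t • (c • f') t
      = ∫ t in Ioo a b, c • (φ t • f' t) := by
    refine integral_congr_ae ?_
    filter_upwards [Lp.coeFn_smul c f'] with t ht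
    rw [ht, Pi.smul_apply, smul_comm]
  rw [e1, e2, integral_smul, integral_smul, hf φ h1 h2 h3, smul_neg]

theorem HasValueAt.zero_L2 (a b x : ℝ) : HasValueAt a b (⇑(0 : L2 a b)) x 0 :=
  ⟨fun _ => 0, continuousOn_const, (Lp.coeFn_zero ℝ 2 (muIoo a b)).symm, rfl⟩

theorem HasValueAt.add_L2 {a b x c d : ℝ} {f g : L2 a b}
    (hf : HasValueAt a b f x c) (hg : HasValueAt a b g x d) :
    HasValueAt a b (⇑(f + g)) x (c + d) := by
  obtain ⟨F, hF, hFf, hFx⟩ := hf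
  obtain ⟨G, hG, hGg, hGx⟩ := hg
  exact ⟨fun t => F t + G t, hF.add hG, (hFf.add hGg).trans (Lp.coeFn_add f g).symm,
    by simp [hFx, hGx]⟩

theorem HasValueAt.smul_L2 {a b x c : ℝ} (k : ℝ) {f : L2 a b}
    (hf : HasValueAt a b f x c) :
    HasValueAt a b (⇑(k • f)) x (k * c) := by
  obtain ⟨F, hF, hFf, hFx⟩ := hf
  exact ⟨fun t => k • F t, hF.const_smul k,
    (hFf.fun_const_smul k).trans (Lp.coeFn_smul k f).symm, by simp [hFx]⟩

/-- The tuples `(f, f', …, f⁽ᵏ⁾)` of functions in `L²(a, b)` each of which is the weak derivative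
of the preceding one. -/
def sobolevSubmodule (k : ℕ) (a b : ℝ) :
    Submodule ℝ (PiLp 2 (fun _ : Fin (k + 1) => L2 a b)) where
  carrier := {F | ∀ i : Fin k, HasWeakDerivOn a b (F i.castSucc) (F i.succ)}
  zero_mem' := fun _ => HasWeakDerivOn.zero_L2 a b
  add_mem' := fun hF hG i => (hF i).add_L2 (hG i)
  smul_mem' := fun c _ hF i => (hF i).smul_L2 c

/-- The Sobolev space `H^k(a, b)`. A function is stored together with its weak derivatives of
order `0, …, k`, all in `L²(a, b)`, so that the inherited norm is the standard one,
`‖f‖² = ∑_{j ≤ k} ‖f⁽ʲ⁾‖²_{L²}`. -/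
def Sobolev (k : ℕ) (a b : ℝ) : Type := sobolevSubmodule k a b

instance (k : ℕ) (a b : ℝ) : NormedAddCommGroup (Sobolev k a b) :=
  inferInstanceAs (NormedAddCommGroup (sobolevSubmodule k a b))

instance (k : ℕ) (a b : ℝ) : InnerProductSpace ℝ (Sobolev k a b) :=
  inferInstanceAs (InnerProductSpace ℝ (sobolevSubmodule k a b))

/-- The weak derivative of order `j` of an element of `H^k(a, b)`; order `0` is the function. -/
def Sobolev.D {k : ℕ} {a b : ℝ} (F : Sobolev k a b) (j : Fin (k + 1)) : L2 a b := F.1 j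

/-- The functions in `H²(0, ℓ)` with `v(0) = 0` and `v_x(0) = 0`. -/
def clampedSubmodule (ℓ : ℝ) : Submodule ℝ (Sobolev 2 0 ℓ) where
  carrier := {v | HasValueAt 0 ℓ (v.D 0) 0 0 ∧ HasValueAt 0 ℓ (v.D 1) 0 0}
  zero_mem' := ⟨HasValueAt.zero_L2 0 ℓ 0, HasValueAt.zero_L2 0 ℓ 0⟩
  add_mem' := by
    rintro v w ⟨hv0, hv1⟩ ⟨hw0, hw1⟩
    have h0 := hv0.add_L2 hw0
    have h1 := hv1.add_L2 hw1
    rw [add_zero] at h0 h1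
    exact ⟨h0, h1⟩
  smul_mem' := by
    rintro c v ⟨hv0, hv1⟩
    have h0 := hv0.smul_L2 c
    have h1 := hv1.smul_L2 c
    rw [mul_zero] at h0 h1
    exact ⟨h0, h1⟩

/-- The space `{v ∈ H²(0, ℓ) : v(0) = v_x(0) = 0}` with the norm of `H²(0, ℓ)`. -/
def ClampedH2 (ℓ : ℝ) : Type := clampedSubmodule ℓ

instance (ℓ : ℝ) : NormedAddCommGroup (ClampedH2 ℓ) :=
  inferInstanceAs (NormedAddCommGroup (clampedSubmodule ℓ))

instance (ℓ : ℝ) : InnerProductSpace ℝ (ClampedH2 ℓ) :=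
  inferInstanceAs (InnerProductSpace ℝ (clampedSubmodule ℓ))

/-- The weak derivative of order `j` of an element of `ClampedH2 ℓ`. -/
def ClampedH2.D {ℓ : ℝ} (v : ClampedH2 ℓ) (j : Fin 3) : L2 0 ℓ := Sobolev.D v.1 j

/-- `u` is a weak solution of the clamped-free beam problem with Kelvin-Voigt damping
`ρ u_tt + μ u_t + (r u_xx)_xx + (κ u_xxt)_xx = 0` on `(0, ℓ) × (0, T)`,
`u(0, t) = u_x(0, t) = 0`, `r u_xx + κ u_xxt = 0` and `-(r u_xx + κ u_xxt)_x = g` at `x = ℓ`,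
`u(0) = u₀`, `u_t(0) = v₀`. -/
def IsWeakSolution (ℓ T : ℝ) (ρ μ r κ g : ℝ → ℝ) (u₀ v₀ : ClampedH2 ℓ)
    (u : ℝ → ClampedH2 ℓ) : Prop :=
  ∃ (ut : ℝ → ClampedH2 ℓ) (utt : ℝ → L2 0 ℓ),
    MemLp u 2 (muIoo 0 T) ∧ MemLp ut 2 (muIoo 0 T) ∧ MemLp utt 2 (muIoo 0 T) ∧
    HasWeakDerivOn 0 T (fun t => (u t).D 0) (fun t => (ut t).D 0) ∧
    HasWeakDerivOn 0 T (fun t => (ut t).D 0) utt ∧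
    (∀ v : ClampedH2 ℓ, ∀ vℓ : ℝ, HasValueAt 0 ℓ (v.D 0) ℓ vℓ →
      ∀ᵐ t ∂(muIoo 0 T),
        (∫ x in Ioo 0 ℓ, ρ x * utt t x * v.D 0 x)
          + (∫ x in Ioo 0 ℓ, μ x * (ut t).D 0 x * v.D 0 x)
          + (∫ x in Ioo 0 ℓ, r x * (u t).D 2 x * v.D 2 x)
          + (∫ x in Ioo 0 ℓ, κ x * (ut t).D 2 x * v.D 2 x)
        = g t * vℓ) ∧
    HasValueAt 0 T u 0 u₀ ∧
    HasValueAt 0 T (fun t => (ut t).D 0) 0 (v₀.D 0)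

/-- `f`, with values in `L²(0, ℓ)`, belongs to `L²(0, T; H^k(0, ℓ))`. -/
def MemL2Sobolev (k : ℕ) (ℓ T : ℝ) (f : ℝ → L2 0 ℓ) : Prop :=
  ∃ F : ℝ → Sobolev k 0 ℓ, MemLp F 2 (muIoo 0 T) ∧ ∀ᵐ t ∂(muIoo 0 T), (F t).D 0 = f t

/-- `f`, with values in `L²(0, ℓ)`, belongs to `L²(0, T; V)`, where `V = ClampedH2 ℓ`. -/
def MemL2Clamped (ℓ T : ℝ) (f : ℝ → L2 0 ℓ) : Prop :=
  ∃ F : ℝ → ClampedH2 ℓ, MemLp F 2 (muIoo 0 T) ∧ ∀ᵐ t ∂(muIoo 0 T), (F t).D 0 = f t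

/-- The constant `C₅²`. -/
def C5sq (ℓ T r₁ κ₀ : ℝ) : ℝ :=
  2 / κ₀ * max (2 * (1 + T) * (ℓ ^ 3 + 3) / (3 * κ₀))
    (κ₀ * ℓ ^ 3 / (2 * (ℓ ^ 3 + 3)) + 2 * r₁ + 2 * T * r₁ ^ 2 * (ℓ ^ 3 + 3) / (3 * κ₀))

end

noncomputable section

/-! Reduction. The clamped end makes `u` a function of its second space derivative: `u = J u_xx`,
with `J` double integration from `0`, and every element of `L²(0, ℓ)` is the second derivative of an
admissible test function. Put `w = u_xxt`, `q = u_tt` and let `V` be integration in time. The weak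
formulation becomes an equation in `L²(0, T; L²(0, ℓ))`, namely `J* ρ q + N w + r V w = V (V f)`
with `J w = V q`. Here `N = κ + J* μ J` is symmetric and bounded below by `κ₀`, and `f = g'' (ℓ -
x)`; the two integrations on the right express `g(0) = g'(0) = 0`
(`IsWeakSolution.exists_secondDeriv`).

Time regularity (`exists_time_derivatives`). A function has a square integrable time derivative and
zero initial value exactly when it lies in the range of `V`. Since `V` is monotone, a vector is in
its range as soon as its images under `D_ε = (V + ε)⁻¹` stay bounded as `ε → 0`
(`exists_of_resolvent_bounded`). These resolvents replace difference quotients: they commute with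
`V` and with every operator acting in space only, so they pass through the equation without error
terms. Pairing the result with `D_ε w` bounds `D_ε w`, because the terms with `ρ` and `r` are
nonnegative; hence `w = V z` and `q = J z`. The function `V D_ε z` then solves the equation
differentiated once in time. Testing with its derivative `D_ε z` and applying Gronwall's lemma
(`energy_estimate`) bounds `D_ε q = J D_ε z` by the constant of the theorem. Hence `q = V q'`, and
`q' = u_ttt` inherits the bound.

Space regularity. The adjoint `J*` integrates twice from the right end and so maps `L²` into `H²`.
Therefore `κ w + r V w = g (ℓ - x) - J* (ρ q + μ J w)` takes values in `H²`. This is a linear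
differential equation in time for `u_xx = V w`, whose coefficients are multiplications preserving
`H²`: in one dimension `H²` is an algebra, closed under reciprocals of functions bounded away from
zero. The equation is solved among `H²`-valued functions, and uniqueness among `L²`-valued ones
identifies the solution with `V w` (`exists_lift_of_ode`). Two integrations in `x` then lead from
`H²` to `H⁴`. -/

theorem ae_mem_Ioo (a b : ℝ) : ∀ᵐ t ∂(muIoo a b), t ∈ Ioo a b :=
  ae_restrict_mem measurableSet_Ioo

theorem intervalIntegrable_of_integrable {E : Type*} [NormedAddCommGroup E] {μ : Measure ℝ}
    {f : ℝ → E} (hf : Integrable f μ)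
    (s t : ℝ) : IntervalIntegrable f μ s t :=
  ⟨hf.integrableOn, hf.integrableOn⟩

theorem memLp_of_continuous {E : Type*} [NormedAddCommGroup E] {a b : ℝ} {f : ℝ → E} (hf : Continuous f) (p : ENNReal) :
    MemLp f p (muIoo a b) := by
  obtain ⟨C, hC⟩ := (isCompact_Icc (a := a) (b := b)).exists_bound_of_continuousOn hf.continuousOn
  refine MemLp.of_bound hf.aestronglyMeasurable C ?_
  filter_upwards [ae_mem_Ioo a b] with t ht using hC t (Ioo_subset_Icc_self ht)

/-! ### Primitives of integrable functions on an interval -/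

section Primitive

variable {E F G : Type*} [NormedAddCommGroup E] [NormedSpace ℝ E] [NormedAddCommGroup F]
  [NormedSpace ℝ F] [NormedAddCommGroup G] [NormedSpace ℝ G] {a b : ℝ}

/-- The primitive `t ↦ ∫_a^t f` of a function on `(a, b)`, as a function on the line. -/
def prim (a b : ℝ) (f : ℝ → E) (t : ℝ) : E := ∫ s in a..t, f s ∂(muIoo a b)

theorem prim_self (f : ℝ → E) : prim a b f a = 0 := intervalIntegral.integral_same

theorem prim_congr {f g : ℝ → E} (h : f =ᵐ[muIoo a b] g) : prim a b f = prim a b g := by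
  funext t
  exact intervalIntegral.integral_congr_ae_restrict
    ((ae_restrict_of_ae (h)))

theorem prim_add {f g : ℝ → E} (hf : Integrable f (muIoo a b)) (hg : Integrable g (muIoo a b))
    (t : ℝ) : prim a b (fun s => f s + g s) t = prim a b f t + prim a b g t :=
  intervalIntegral.integral_add (intervalIntegrable_of_integrable hf _ _)
    (intervalIntegrable_of_integrable hg _ _)

theorem prim_smul (c : ℝ) (f : ℝ → E) (t : ℝ) :
    prim a b (fun s => c • f s) t = c • prim a b f t :=
  intervalIntegral.integral_smul _ _

theorem prim_clm [CompleteSpace E] [CompleteSpace F] (A : E →L[ℝ] F) {f : ℝ → E}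
    (hf : Integrable f (muIoo a b)) (t : ℝ) :
    prim a b (fun s => A (f s)) t = A (prim a b f t) :=
  A.intervalIntegral_comp_comm (intervalIntegrable_of_integrable hf _ _)

theorem continuous_prim {f : ℝ → E} (hf : Integrable f (muIoo a b)) :
    Continuous (prim a b f) :=
  intervalIntegral.continuous_primitive (intervalIntegrable_of_integrable hf) a

theorem prim_eq_integral {f : ℝ → E} (hab : a ≤ b) : prim a b f b = ∫ t in Ioo a b, f t := by
  rw [prim, intervalIntegral.integral_of_le hab, Measure.restrict_restrict measurableSet_Ioc,
    inter_eq_self_of_subset_right Ioo_subset_Ioc_self]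

/-- Only the end point `b` can lie in `Ioc a t` but not in `Ioo a b`, and it is a null set. -/
theorem muIoo_restrict_Ioc {t : ℝ} (ht : t ∈ Icc a b) :
    (muIoo a b).restrict (Ioc a t) = volume.restrict (Ioc a t) := by
  rw [muIoo, Measure.restrict_restrict measurableSet_Ioc]
  refine Measure.restrict_congr_set ?_
  have h1 : (Ioc a t ∩ Ioo a b : Set ℝ) =ᵐ[volume] (Ioc a t ∩ Ioc a b : Set ℝ) :=
    (Filter.EventuallyEq.refl _ _).inter Ioo_ae_eq_Ioc
  rwa [inter_eq_self_of_subset_left (Ioc_subset_Ioc_right ht.2)] at h1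

theorem prim_eq_intervalIntegral {f : ℝ → E} {t : ℝ} (ht : t ∈ Icc a b) :
    prim a b f t = ∫ s in a..t, f s := by
  rw [prim, intervalIntegral.integral_of_le ht.1, intervalIntegral.integral_of_le ht.1,
    muIoo_restrict_Ioc ht]

theorem norm_prim_le_prim_norm {f : ℝ → E} {t : ℝ} (ht : a ≤ t) :
    ‖prim a b f t‖ ≤ prim a b (fun s => ‖f s‖) t :=
  intervalIntegral.norm_integral_le_integral_norm ht

theorem prim_nonneg {f : ℝ → ℝ} (hf : ∀ᵐ s ∂(muIoo a b), 0 ≤ f s) {t : ℝ} (ht : a ≤ t) :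
    0 ≤ prim a b f t :=
  intervalIntegral.integral_nonneg_of_ae_restrict ht (ae_restrict_of_ae hf)

theorem prim_mono {f g : ℝ → ℝ} (hf : Integrable f (muIoo a b)) (hg : Integrable g (muIoo a b))
    (h : ∀ᵐ s ∂(muIoo a b), f s ≤ g s) {t : ℝ} (ht : a ≤ t) :
    prim a b f t ≤ prim a b g t :=
  intervalIntegral.integral_mono_ae ht (intervalIntegrable_of_integrable hf _ _)
    (intervalIntegrable_of_integrable hg _ _) h

theorem prim_le_integral {f : ℝ → ℝ} (hf : Integrable f (muIoo a b))
    (h : ∀ᵐ s ∂(muIoo a b), 0 ≤ f s) {t : ℝ} (ht : a ≤ t) :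
    prim a b f t ≤ ∫ s in Ioo a b, f s := by
  rw [prim, intervalIntegral.integral_of_le ht]
  exact integral_mono_measure Measure.restrict_le_self h hf

theorem prim_const {t : ℝ} (ht : t ∈ Icc a b) (c : ℝ) :
    prim a b (fun _ => c) t = (t - a) * c := by
  rw [prim_eq_intervalIntegral ht]; simp

/-- The Cauchy-Schwarz inequality for the integral over `(a, t)`. -/
theorem sq_prim_le {f : ℝ → ℝ} (hf : MemLp f 2 (muIoo a b)) {t : ℝ} (ht : t ∈ Icc a b) :
    prim a b f t ^ 2 ≤ (t - a) * prim a b (fun s => f s ^ 2) t := by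
  have h1 : Integrable f (muIoo a b) := hf.integrable (by norm_num)
  have h2 : Integrable (fun s => f s ^ 2) (muIoo a b) := hf.integrable_sq
  rcases eq_or_lt_of_le ht.1 with h | h
  · subst h; simp [prim_self]
  have key : ∀ c : ℝ, 0 ≤ prim a b (fun s => f s ^ 2) t - 2 * c * prim a b f t + (t - a) * c ^ 2 := by
    intro c
    have e : prim a b (fun s => (f s - c) ^ 2) t
        = prim a b (fun s => f s ^ 2) t - 2 * c * prim a b f t + (t - a) * c ^ 2 := by
      have : (fun s => (f s - c) ^ 2) = fun s => f s ^ 2 + ((-(2 * c)) • f s + c ^ 2) := by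
        funext s; simp only [smul_eq_mul]; ring
      have i1 : Integrable (fun s => (-(2 * c)) • f s) (muIoo a b) := h1.const_mul _
      have i2 : Integrable (fun s => (-(2 * c)) • f s + c ^ 2) (muIoo a b) :=
        i1.add (integrable_const _)
      rw [this, prim_add h2 i2, prim_add i1 (integrable_const _), prim_smul, prim_const ht]
      simp only [smul_eq_mul]; ring
    rw [← e]
    exact prim_nonneg (Filter.Eventually.of_forall fun s => sq_nonneg _) ht.1
  -- The quadratic in `c` is smallest at the mean value of `f` over `(a, t)`.
  have := key (prim a b f t / (t - a))
  have hpos : 0 < t - a := by linarith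
  have e2 : prim a b (fun s => f s ^ 2) t - 2 * (prim a b f t / (t - a)) * prim a b f t
      + (t - a) * (prim a b f t / (t - a)) ^ 2
      = ((t - a) * prim a b (fun s => f s ^ 2) t - prim a b f t ^ 2) / (t - a) := by
    field_simp; ring
  rw [e2] at this
  have := (div_nonneg_iff.1 this)
  rcases this with h | h <;> linarith [h.1, h.2]

/-- Integration by parts for primitives, with values paired by a continuous bilinear map. -/
theorem bilin_prim_prim [CompleteSpace E] [CompleteSpace F] [CompleteSpace G]
    (B : E →L[ℝ] F →L[ℝ] G) {f : ℝ → E} {g : ℝ → F} (hf : Integrable f (muIoo a b))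
    (hg : Integrable g (muIoo a b)) {t : ℝ} (ht : a ≤ t) :
    B (prim a b f t) (prim a b g t)
      = prim a b (fun s => B (f s) (prim a b g s) + B (prim a b f s) (g s)) t := by
  have i1 : Integrable (fun s => B (f s) (prim a b g s)) (muIoo a b) := by
    obtain ⟨C, hC⟩ := (isCompact_Icc (a := a) (b := b)).exists_bound_of_continuousOn
      (continuous_prim hg).continuousOn
    refine Integrable.mono' (g := fun s => ‖B‖ * C * ‖f s‖) (hf.norm.const_mul _)
      (B.aestronglyMeasurable_comp₂ hf.1 (continuous_prim hg).aestronglyMeasurable) ?_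
    filter_upwards [ae_mem_Ioo a b] with s hs
    calc ‖B (f s) (prim a b g s)‖ ≤ ‖B‖ * ‖f s‖ * ‖prim a b g s‖ := B.le_opNorm₂ _ _
      _ ≤ ‖B‖ * ‖f s‖ * C := by gcongr; exact hC s (Ioo_subset_Icc_self hs)
      _ = _ := by ring
  have i2 : Integrable (fun s => B (prim a b f s) (g s)) (muIoo a b) := by
    obtain ⟨C, hC⟩ := (isCompact_Icc (a := a) (b := b)).exists_bound_of_continuousOn
      (continuous_prim hf).continuousOn
    refine Integrable.mono' (g := fun s => ‖B‖ * C * ‖g s‖) (hg.norm.const_mul _)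
      (B.aestronglyMeasurable_comp₂ (continuous_prim hf).aestronglyMeasurable hg.1) ?_
    filter_upwards [ae_mem_Ioo a b] with s hs
    calc ‖B (prim a b f s) (g s)‖ ≤ ‖B‖ * ‖prim a b f s‖ * ‖g s‖ := B.le_opNorm₂ _ _
      _ ≤ ‖B‖ * C * ‖g s‖ := by gcongr; exact hC s (Ioo_subset_Icc_self hs)
  rw [prim_add i1 i2]
  set ν := (muIoo a b).restrict (Ioc a t) with hν
  have hfν : Integrable f ν := hf.restrict
  have hgν : Integrable g ν := hg.restrict
  have memν : ∀ᵐ s ∂ν, s ∈ Ioc a t := ae_restrict_mem measurableSet_Ioc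
  have pf : prim a b f t = ∫ s, f s ∂ν := intervalIntegral.integral_of_le ht
  have pg : prim a b g t = ∫ s, g s ∂ν := intervalIntegral.integral_of_le ht
  have prf : ∀ s ∈ Ioc a t, prim a b f s = ∫ x in Iio s, f x ∂ν := by
    intro s hs
    rw [prim, intervalIntegral.integral_of_le hs.1.le, hν, Measure.restrict_restrict measurableSet_Iio]
    refine (setIntegral_congr_set ?_)
    have : (Ioc a s : Set ℝ) = Iic s ∩ Ioc a t := by
      ext x; simp only [mem_Ioc, mem_inter_iff, mem_Iic]
      exact ⟨fun h => ⟨h.2, h.1, h.2.trans hs.2⟩, fun h => ⟨h.2.1, h.1⟩⟩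
    rw [this]
    exact Iio_ae_eq_Iic.symm.inter (Filter.EventuallyEq.refl _ _)
  have prg : ∀ s ∈ Ioc a t, prim a b g s = ∫ x in Iic s, g x ∂ν := by
    intro s hs
    rw [prim, intervalIntegral.integral_of_le hs.1.le, hν, Measure.restrict_restrict measurableSet_Iic]
    congr 2
    ext x; simp only [mem_Ioc, mem_inter_iff, mem_Iic]
    exact ⟨fun h => ⟨h.2, h.1, h.2.trans hs.2⟩, fun h => ⟨h.2.1, h.1⟩⟩
  have eq1 : prim a b (fun s => B (f s) (prim a b g s)) t
      = ∫ x, ∫ y in Iic x, B (f x) (g y) ∂ν ∂ν := by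
    rw [prim, intervalIntegral.integral_of_le ht]
    refine integral_congr_ae ?_
    filter_upwards [memν] with x hx
    rw [prg x hx, (B (f x)).integral_comp_comm hgν.restrict]
  have eq2 : prim a b (fun s => B (prim a b f s) (g s)) t
      = ∫ y, ∫ x in Iio y, B (f x) (g y) ∂ν ∂ν := by
    rw [prim, intervalIntegral.integral_of_le ht]
    refine integral_congr_ae ?_
    filter_upwards [memν] with y hy
    rw [prf y hy]
    exact ((B.flip (g y)).integral_comp_comm hfν.restrict).symm
  -- Fubini on the square `(a, t] × (a, t]`: the part `y ≤ x` is `eq1` and the part `x < y` is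
  -- `eq2`, so no differentiability of the primitives is needed.
  have hprod : Integrable (fun z : ℝ × ℝ => B (f z.1) (g z.2)) (ν.prod ν) := by
    refine Integrable.op_fst_snd (op := fun x y => B x y) ?_ ⟨‖B‖, fun x y => B.le_opNorm₂ x y⟩
      hfν hgν
    exact B.continuous₂
  have hset : MeasurableSet {z : ℝ × ℝ | z.1 < z.2} := measurableSet_lt measurable_fst measurable_snd
  have swap : ∫ y, ∫ x in Iio y, B (f x) (g y) ∂ν ∂ν = ∫ x, ∫ y in Ioi x, B (f x) (g y) ∂ν ∂ν := by
    have := integral_integral_swap (μ := ν) (ν := ν)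
      (f := fun x y => {z : ℝ × ℝ | z.1 < z.2}.indicator (fun z => B (f z.1) (g z.2)) (x, y))
      (hprod.indicator hset)
    have l : ∀ x, ∫ y, {z : ℝ × ℝ | z.1 < z.2}.indicator (fun z => B (f z.1) (g z.2)) (x, y) ∂ν
        = ∫ y in Ioi x, B (f x) (g y) ∂ν := by
      intro x; rw [← integral_indicator measurableSet_Ioi]; rfl
    have r : ∀ y, ∫ x, {z : ℝ × ℝ | z.1 < z.2}.indicator (fun z => B (f z.1) (g z.2)) (x, y) ∂ν
        = ∫ x in Iio y, B (f x) (g y) ∂ν := by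
      intro x; rw [← integral_indicator measurableSet_Iio]; rfl
    simp only [l, r] at this
    exact this.symm
  have hcompl : ∀ x, ∫ y in Iic x, B (f x) (g y) ∂ν
      = ∫ y, B (f x) (g y) ∂ν - ∫ y in Ioi x, B (f x) (g y) ∂ν := by
    intro x
    have := integral_add_compl (measurableSet_Iic (a := x)) ((B (f x)).integrable_comp hgν)
    rw [compl_Iic] at this
    exact eq_sub_of_add_eq this
  have i3 : Integrable (fun x => ∫ y in Ioi x, B (f x) (g y) ∂ν) ν := by
    have := (hprod.indicator hset).integral_prod_left
    refine this.congr (Filter.Eventually.of_forall fun x => ?_)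
    simp only
    rw [← integral_indicator measurableSet_Ioi]; rfl
  have i4 : Integrable (fun x => ∫ y, B (f x) (g y) ∂ν) ν := hprod.integral_prod_left
  rw [eq1, eq2, swap]
  simp only [hcompl]
  rw [integral_sub i4 i3, sub_add_cancel, pf, pg]
  have : ∀ x, ∫ y, B (f x) (g y) ∂ν = B (f x) (∫ y, g y ∂ν) := fun x =>
    (B (f x)).integral_comp_comm hgν
  simp only [this]
  exact ((B.flip (∫ y, g y ∂ν)).integral_comp_comm hfν).symm

end Primitive

theorem integrable_of_Lp {E : Type*} [NormedAddCommGroup E] {a b : ℝ} (f : Lp E 2 (muIoo a b)) : Integrable f (muIoo a b) :=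
  (Lp.memLp f).integrable (by norm_num)

theorem norm_sq_eq_integral {E : Type*} [NormedAddCommGroup E] {a b : ℝ}
    (f : Lp E 2 (muIoo a b)) :
    ‖f‖ ^ 2 = ∫ s in Ioo a b, ‖f s‖ ^ 2 := by
  rw [Lp.norm_def, (Lp.memLp f).eLpNorm_eq_integral_rpow_norm (by norm_num) (by norm_num)]
  rw [ENNReal.toReal_ofReal (by positivity)]
  norm_num
  rw [← Real.sqrt_eq_rpow, Real.sq_sqrt]
  exact integral_nonneg fun _ => by positivity

theorem integral_norm_le {E : Type*} [NormedAddCommGroup E] {a b : ℝ}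
    (f : Lp E 2 (muIoo a b)) (hab : a ≤ b) :
    ∫ s in Ioo a b, ‖f s‖ ≤ √(b - a) * ‖f‖ := by
  have h := sq_prim_le (Lp.memLp f).norm (right_mem_Icc.2 hab)
  rw [prim_eq_integral hab, prim_eq_integral hab, ← norm_sq_eq_integral] at h
  rw [← Real.sqrt_sq (norm_nonneg f), ← Real.sqrt_mul (by linarith)]
  exact Real.le_sqrt_of_sq_le h

/-! ### Integration as a quasinilpotent operator on `L²(a, b; E)` -/

section Volterra

variable {E F : Type*} [NormedAddCommGroup E] [NormedSpace ℝ E] [NormedAddCommGroup F]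
  [NormedSpace ℝ F] {a b : ℝ}

theorem memLp_prim {f : ℝ → E} (hf : Integrable f (muIoo a b)) :
    MemLp (prim a b f) 2 (muIoo a b) :=
  memLp_of_continuous (continuous_prim hf) 2

theorem norm_prim_le_integral {f : ℝ → E} (hf : Integrable f (muIoo a b)) {t : ℝ} (ht : a ≤ t) :
    ‖prim a b f t‖ ≤ ∫ s in Ioo a b, ‖f s‖ :=
  (norm_prim_le_prim_norm ht).trans
    (prim_le_integral hf.norm (Filter.Eventually.of_forall fun _ => norm_nonneg _) ht)

/-- Integration from the left end point as a bounded operator on `L²(a, b; E)`. -/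
def volterra (a b : ℝ) (E : Type*) [NormedAddCommGroup E] [NormedSpace ℝ E] :
    Lp E 2 (muIoo a b) →L[ℝ] Lp E 2 (muIoo a b) :=
  LinearMap.mkContinuous
    { toFun := fun f => (memLp_prim (integrable_of_Lp f)).toLp _
      map_add' := fun f g => by
        rw [← MemLp.toLp_add]
        congr 1
        funext t
        rw [Pi.add_apply, ← prim_add (integrable_of_Lp f) (integrable_of_Lp g)]
        exact congrFun (prim_congr (Lp.coeFn_add f g)) t
      map_smul' := fun c f => by
        rw [RingHom.id_apply, ← MemLp.toLp_const_smul]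
        congr 1
        funext t
        rw [Pi.smul_apply, ← prim_smul]
        exact congrFun (prim_congr (Lp.coeFn_smul c f)) t }
    -- The primitive is bounded by `√(b - a) * ‖f‖`; the other factor is the `L²` norm of the
    -- constant `1`.
    ((measureUnivNNReal (muIoo a b) : ℝ) ^ (2 : ENNReal).toReal⁻¹ * √(b - a)) (by
      intro f
      by_cases hab : a ≤ b
      · rw [mul_assoc]
        refine (Lp.norm_le_of_ae_bound (C := √(b - a) * ‖f‖) (by positivity) ?_).trans_eq rfl
        filter_upwards [(memLp_prim (integrable_of_Lp f)).coeFn_toLp, ae_mem_Ioo a b] with t h1 h2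
        simp only [LinearMap.coe_mk, AddHom.coe_mk, h1]
        exact (norm_prim_le_integral (integrable_of_Lp f) h2.1.le).trans (integral_norm_le f hab)
      · refine (Lp.norm_le_of_ae_bound (C := 0) le_rfl ?_).trans ?_
        · filter_upwards [ae_mem_Ioo a b] with t ht
          exact absurd (ht.1.trans ht.2).le hab
        · simp only [mul_zero]; positivity)

theorem coeFn_volterra (f : Lp E 2 (muIoo a b)) : volterra a b E f =ᵐ[muIoo a b] prim a b f :=
  (memLp_prim (integrable_of_Lp f)).coeFn_toLp

/-- A bounded operator in space passes through an integral in time. This is what lets the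
coefficients commute with integration and its resolvents. -/
theorem compLpL_volterra [CompleteSpace E] [CompleteSpace F] (A : E →L[ℝ] F)
    (f : Lp E 2 (muIoo a b)) :
    A.compLpL 2 (muIoo a b) (volterra a b E f) = volterra a b F (A.compLpL 2 (muIoo a b) f) := by
  apply Lp.ext
  filter_upwards [A.coeFn_compLpL (volterra a b E f), coeFn_volterra f,
    coeFn_volterra (A.compLpL 2 (muIoo a b) f)] with t h1 h2 h3
  rw [h1, h2, h3, prim_congr (A.coeFn_compLpL f), prim_clm A (integrable_of_Lp f)]

/-- The first integration is controlled by Cauchy-Schwarz; each further one turns `(t - a)^n / n!`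
into `(t - a)^(n+1) / (n+1)!`. The factorial makes the spectral radius zero. -/
theorem norm_volterra_iterate_le (hab : a ≤ b) (f : Lp E 2 (muIoo a b)) (n : ℕ) :
    ∀ᵐ t ∂(muIoo a b), ‖((volterra a b E) ^ (n + 1)) f t‖
      ≤ (t - a) ^ n / n.factorial * (√(b - a) * ‖f‖) := by
  induction n with
  | zero =>
    filter_upwards [coeFn_volterra f, ae_mem_Ioo a b] with t h1 h2
    simp only [zero_add, pow_one, pow_zero, Nat.factorial_zero, Nat.cast_one, div_one, one_mul, h1]
    exact (norm_prim_le_integral (integrable_of_Lp f) h2.1.le).trans (integral_norm_le f hab)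
  | succ n ih =>
    filter_upwards [coeFn_volterra (((volterra a b E) ^ (n + 1)) f), ae_mem_Ioo a b] with t h1 h2
    rw [pow_succ' _ (n + 1), mul_apply_eq_comp, h1]
    refine (norm_prim_le_prim_norm h2.1.le).trans ?_
    have hc : Continuous fun s : ℝ => (s - a) ^ n / n.factorial * (√(b - a) * ‖f‖) := by fun_prop
    refine (prim_mono (integrable_of_Lp _).norm
      ((memLp_of_continuous hc 1).integrable le_rfl) ih h2.1.le).trans_eq ?_
    rw [prim_eq_intervalIntegral ⟨h2.1.le, h2.2.le⟩, intervalIntegral.integral_mul_const,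
      intervalIntegral.integral_div, intervalIntegral.integral_comp_sub_right (fun s => s ^ n) a,
      integral_pow, Nat.factorial_succ]
    push_cast
    simp only [sub_self, ne_eq, Nat.add_eq_zero_iff, one_ne_zero, and_false, not_false_eq_true,
      zero_pow, sub_zero]
    field_simp

theorem norm_volterra_pow_le (hab : a ≤ b) (n : ℕ) :
    ‖(volterra a b E) ^ (n + 1)‖ ≤ (b - a) ^ n / n.factorial *
      ((measureUnivNNReal (muIoo a b) : ℝ) ^ (2 : ENNReal).toReal⁻¹ * √(b - a)) := by
  have hb : 0 ≤ b - a := by linarith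
  refine ContinuousLinearMap.opNorm_le_bound _ (by positivity) fun f => ?_
  refine (Lp.norm_le_of_ae_bound (C := (b - a) ^ n / n.factorial * (√(b - a) * ‖f‖))
    (by positivity) ?_).trans_eq ?_
  · filter_upwards [norm_volterra_iterate_le hab f n, ae_mem_Ioo a b] with t h1 h2
    refine h1.trans ?_
    have := h2.1
    have := h2.2
    gcongr
  · ring_nf

/-- Volterra equations of the second kind with bounded operator coefficients are solvable. -/
theorem isUnit_one_sub_volterra_mul (hab : a ≤ b) {A : Lp E 2 (muIoo a b) →L[ℝ] Lp E 2 (muIoo a b)}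
    (hA : Commute (volterra a b E) A) [CompleteSpace E] :
    IsUnit (1 - volterra a b E * A) := by
  set V := volterra a b E
  set K := (measureUnivNNReal (muIoo a b) : ℝ) ^ (2 : ENNReal).toReal⁻¹ * √(b - a)
  have hlim : Filter.Tendsto (fun n : ℕ => ((b - a) * ‖A‖) ^ n / n.factorial * (K * ‖A‖))
      Filter.atTop (nhds 0) := by
    have := (FloorSemiring.tendsto_pow_div_factorial_atTop ((b - a) * ‖A‖)).mul_const (K * ‖A‖)
    rwa [zero_mul] at this
  -- Some power of `V * A` is a contraction, since `(V * A)^(n+1) = V^(n+1) * A^(n+1)` and the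
  -- factorial beats `‖A‖^(n+1)`.
  obtain ⟨n, hn⟩ := (hlim.eventually (gt_mem_nhds one_pos)).exists
  have hsmall : ‖(V * A) ^ (n + 1)‖ < 1 := by
    rw [hA.mul_pow]
    refine (norm_mul_le _ _).trans_lt (lt_of_le_of_lt ?_ hn)
    calc ‖V ^ (n + 1)‖ * ‖A ^ (n + 1)‖
        ≤ ((b - a) ^ n / n.factorial * K) * ‖A‖ ^ (n + 1) :=
          mul_le_mul (norm_volterra_pow_le hab n) (norm_pow_le' _ n.succ_pos) (norm_nonneg _)
            (by have : 0 ≤ b - a := by linarith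
                positivity)
      _ = _ := by rw [mul_pow, pow_succ]; ring
  have hu := isUnit_one_sub_of_norm_lt_one hsmall
  -- The unit `1 - (V * A)^(n+1)` is `1 - V * A` times a geometric sum commuting with it, so both
  -- factors are units.
  rw [← mul_neg_geom_sum] at hu
  refine (Commute.isUnit_mul_iff ?_).1 hu |>.1
  exact Commute.sub_left (Commute.one_left _)
    (Commute.sum_right _ _ _ fun i _ => Commute.pow_right (Commute.refl _) i)

end Volterra

/-! ### Resolvents of integration as regularised time derivatives -/

section Resolvent

variable {E F : Type*} [NormedAddCommGroup E] [NormedSpace ℝ E] [CompleteSpace E]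
  [NormedAddCommGroup F] [NormedSpace ℝ F] [CompleteSpace F] {a b : ℝ}

/-- The resolvent `(V + ε)⁻¹` of the integration operator `V`. -/
def volterraResolvent (a b : ℝ) (E : Type*) [NormedAddCommGroup E] [NormedSpace ℝ E] (ε : ℝ) :
    Lp E 2 (muIoo a b) →L[ℝ] Lp E 2 (muIoo a b) :=
  Ring.inverse (volterra a b E + ε • 1)

/-- Factor `V + ε = ε (1 - V (-ε⁻¹))` and use the solvability of Volterra equations for the scalar
`-ε⁻¹`. -/
theorem isUnit_volterra_add (hab : a ≤ b) {ε : ℝ} (hε : ε ≠ 0) :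
    IsUnit (volterra a b E + ε • (1 : Lp E 2 (muIoo a b) →L[ℝ] Lp E 2 (muIoo a b))) := by
  have h := isUnit_one_sub_volterra_mul (E := E) hab (A := (-ε⁻¹) • 1)
    ((Commute.one_right _).smul_right _)
  have h2 : IsUnit (ε • (1 : Lp E 2 (muIoo a b) →L[ℝ] Lp E 2 (muIoo a b))) :=
    ⟨⟨ε • 1, ε⁻¹ • 1, by rw [smul_mul_smul_comm, mul_inv_cancel₀ hε, one_smul, one_mul],
      by rw [smul_mul_smul_comm, inv_mul_cancel₀ hε, one_smul, one_mul]⟩, rfl⟩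
  have h3 := h2.mul h
  convert h3 using 1
  rw [mul_smul_comm, mul_one, neg_smul, sub_neg_eq_add, smul_mul_assoc, one_mul, smul_add,
    smul_smul, mul_inv_cancel₀ hε, one_smul, add_comm]

theorem volterra_resolvent_add (hab : a ≤ b) {ε : ℝ} (hε : ε ≠ 0) (f : Lp E 2 (muIoo a b)) :
    volterra a b E (volterraResolvent a b E ε f) + ε • volterraResolvent a b E ε f = f :=
  congrArg (fun L : Lp E 2 (muIoo a b) →L[ℝ] Lp E 2 (muIoo a b) => L f)
    (Ring.mul_inverse_cancel _ (isUnit_volterra_add (E := E) hab hε))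

theorem resolvent_volterra_add (hab : a ≤ b) {ε : ℝ} (hε : ε ≠ 0) (f : Lp E 2 (muIoo a b)) :
    volterraResolvent a b E ε (volterra a b E f + ε • f) = f :=
  congrArg (fun L : Lp E 2 (muIoo a b) →L[ℝ] Lp E 2 (muIoo a b) => L f)
    (Ring.inverse_mul_cancel _ (isUnit_volterra_add (E := E) hab hε))

/-- An operator intertwining the integrations intertwines `V + ε`, hence also its inverse. -/
theorem resolvent_comm (hab : a ≤ b) {ε : ℝ} (hε : ε ≠ 0)
    (A : Lp E 2 (muIoo a b) →L[ℝ] Lp F 2 (muIoo a b))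
    (hA : ∀ f, A (volterra a b E f) = volterra a b F (A f)) (f : Lp E 2 (muIoo a b)) :
    volterraResolvent a b F ε (A f) = A (volterraResolvent a b E ε f) := by
  conv_lhs => rw [← volterra_resolvent_add hab hε f, map_add, hA, map_smul]
  exact resolvent_volterra_add hab hε _

theorem resolvent_volterra (hab : a ≤ b) {ε : ℝ} (hε : ε ≠ 0) (f : Lp E 2 (muIoo a b)) :
    volterraResolvent a b E ε (volterra a b E f) = volterra a b E (volterraResolvent a b E ε f) :=
  resolvent_comm hab hε _ (fun _ => rfl) f

theorem resolvent_compLpL (hab : a ≤ b) {ε : ℝ} (hε : ε ≠ 0) (A : E →L[ℝ] F)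
    (f : Lp E 2 (muIoo a b)) :
    volterraResolvent a b F ε (A.compLpL 2 (muIoo a b) f)
      = A.compLpL 2 (muIoo a b) (volterraResolvent a b E ε f) :=
  resolvent_comm hab hε _ (compLpL_volterra A) f

/-- If the primitive vanishes almost everywhere, it vanishes throughout `(a, b)` by continuity; by
Lebesgue's differentiation theorem its derivative is almost everywhere the integrand. -/
theorem volterra_injective : Function.Injective (volterra a b E) := by
  rw [injective_iff_map_eq_zero]
  intro f hf
  by_cases hab : a ≤ b
  swap
  · apply Lp.ext
    filter_upwards [ae_mem_Ioo a b] with t ht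
    exact absurd (ht.1.trans ht.2).le hab
  have h0 : ∀ t ∈ Ioo a b, prim a b f t = 0 := by
    have h1 : prim a b f =ᵐ[muIoo a b] fun _ => 0 := by
      refine (coeFn_volterra f).symm.trans ?_
      rw [hf]
      exact Lp.coeFn_zero _ _ _
    have h2 := Measure.eqOn_Ioo_of_ae_eq volume h1
      (continuous_prim (integrable_of_Lp f)).continuousOn continuousOn_const
    exact h2
  have hi : IntervalIntegrable f volume a b :=
    (intervalIntegrable_iff_integrableOn_Ioo_of_le hab).2 (integrable_of_Lp f)
  apply Lp.ext
  have hae := ae_restrict_of_ae (s := Ioo a b) hi.ae_hasDerivAt_integral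
  filter_upwards [hae, ae_mem_Ioo a b, Lp.coeFn_zero E 2 (muIoo a b)] with t h1 h2 h3
  rw [h3]
  rw [uIcc_of_le hab] at h1
  have h4 := h1 (Ioo_subset_Icc_self h2) a (left_mem_Icc.2 hab)
  refine h4.unique ?_
  refine (hasDerivAt_const t (0 : E)).congr_of_eventuallyEq ?_
  filter_upwards [Ioo_mem_nhds h2.1 h2.2] with s hs
  rw [← prim_eq_intervalIntegral (Ioo_subset_Icc_self hs), h0 s hs]

end Resolvent

/-! ### Monotone operators on a Hilbert space -/

section Accretive

variable {X : Type*} [NormedAddCommGroup X] [InnerProductSpace ℝ X]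

local notation "⟪" x ", " y "⟫" => inner ℝ x y

/-- Monotonicity at `x - y`, where `V (x - y) = δ • y - ε • x`, yields `⟪x, y⟫ ≥ ‖y‖²`; then expand
the square. Norms increase as `ε` decreases, and an upper bound on them makes the family Cauchy. -/
theorem norm_resolvent_sub_sq_le {V : X →L[ℝ] X} (hV : ∀ x, 0 ≤ ⟪V x, x⟫) {ε δ : ℝ} (hε : 0 < ε)
    (hεδ : ε < δ) {f x y : X} (hx : V x + ε • x = f) (hy : V y + δ • y = f) :
    ‖x - y‖ ^ 2 ≤ ‖x‖ ^ 2 - ‖y‖ ^ 2 := by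
  have h1 : V (x - y) = δ • y - ε • x := by
    rw [map_sub, eq_sub_of_add_eq hx, eq_sub_of_add_eq hy]; abel
  have h2 := hV (x - y)
  rw [h1] at h2
  simp only [inner_sub_left, inner_sub_right, inner_smul_left, RCLike.conj_to_real,
    real_inner_self_eq_norm_sq, real_inner_comm x y] at h2
  rw [norm_sub_sq_real]
  have h3 : ‖x - y‖ ^ 2 = ‖x‖ ^ 2 - 2 * ⟪x, y⟫ + ‖y‖ ^ 2 := norm_sub_sq_real x y
  have h4 := sq_nonneg ‖x - y‖
  rw [h3] at h4
  have h6 : 0 ≤ (δ - ε) * (⟪x, y⟫ - ‖y‖ ^ 2) := by nlinarith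
  have h7 := nonneg_of_mul_nonneg_right h6 (sub_pos.2 hεδ)
  linarith

/-- If the resolvents of a monotone operator `V` are bounded at `f`, then `f` is in the range. -/
theorem exists_of_resolvent_bounded [CompleteSpace X] {V : X →L[ℝ] X} (hV : ∀ x, 0 ≤ ⟪V x, x⟫)
    {f : X} {K : ℝ} {x : ℝ → X} (hx : ∀ ε > 0, V (x ε) + ε • x ε = f)
    (hK : ∀ ε > 0, ‖x ε‖ ≤ K) : ∃ y, V y = f ∧ ‖y‖ ≤ K := by
  set e : ℕ → ℝ := fun n => 1 / ((n : ℝ) + 1) with he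
  have hpos : ∀ n, 0 < e n := fun n => Nat.one_div_pos_of_nat
  have hanti : ∀ n m, n < m → e m < e n := fun n m h => Nat.one_div_lt_one_div h
  have key : ∀ n m, n ≤ m → ‖x (e m) - x (e n)‖ ^ 2 ≤ ‖x (e m)‖ ^ 2 - ‖x (e n)‖ ^ 2 := by
    intro n m h
    rcases h.eq_or_lt with rfl | h
    · simp
    · exact norm_resolvent_sub_sq_le hV (hpos m) (hanti n m h) (hx _ (hpos m)) (hx _ (hpos n))
  have hmono : Monotone fun n => ‖x (e n)‖ ^ 2 := fun n m h => by
    have := key n m h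
    have := sq_nonneg ‖x (e m) - x (e n)‖
    simp only; linarith
  -- The squared norms form a bounded monotone sequence, and their increments dominate the squared
  -- distances.
  have hbdd : BddAbove (range fun n => ‖x (e n)‖ ^ 2) := by
    refine ⟨K ^ 2, ?_⟩
    rintro _ ⟨n, rfl⟩
    have := hK _ (hpos n)
    simp only; gcongr
  have hc := (tendsto_atTop_ciSup hmono hbdd).cauchySeq
  have hcx : CauchySeq fun n => x (e n) := by
    rw [Metric.cauchySeq_iff'] at hc ⊢
    intro η hη
    obtain ⟨N, hN⟩ := hc (η ^ 2) (by positivity)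
    refine ⟨N, fun n hn => ?_⟩
    have h1 := hN n hn
    rw [Real.dist_eq] at h1
    have h2 := (key N n hn).trans_lt ((le_abs_self _).trans_lt h1)
    rw [dist_eq_norm]
    exact lt_of_pow_lt_pow_left₀ 2 hη.le h2
  obtain ⟨y, hy⟩ := cauchySeq_tendsto_of_complete hcx
  refine ⟨y, ?_, le_of_tendsto hy.norm (Filter.Eventually.of_forall fun n => hK _ (hpos n))⟩
  have h1 : Filter.Tendsto (fun n => V (x (e n)) + e n • x (e n)) Filter.atTop (nhds (V y + (0 : ℝ) • y)) :=
    ((V.continuous.tendsto y).comp hy).add ((tendsto_one_div_add_atTop_nhds_zero_nat).smul hy)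
  have h2 : (fun n => V (x (e n)) + e n • x (e n)) = fun _ => f := funext fun n => hx _ (hpos n)
  rw [h2, zero_smul, add_zero] at h1
  exact tendsto_nhds_unique h1 tendsto_const_nhds

end Accretive

/-! ### Positivity of time integration in Hilbert-valued `L²` -/

theorem integrable_inner {H : Type*} [NormedAddCommGroup H] [InnerProductSpace ℝ H] {a b : ℝ}
    {f g : ℝ → H} (hf : MemLp f 2 (muIoo a b)) (hg : MemLp g 2 (muIoo a b)) :
    Integrable (fun s => inner ℝ (f s) (g s)) (muIoo a b) := by
  have := L2.integrable_inner (𝕜 := ℝ) (hf.toLp f) (hg.toLp g)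
  refine this.congr ?_
  filter_upwards [hf.coeFn_toLp, hg.coeFn_toLp] with t h1 h2
  rw [h1, h2]

section HilbertValued

variable {H : Type*} [NormedAddCommGroup H] [InnerProductSpace ℝ H] [CompleteSpace H] {a b : ℝ}

local notation "⟪" x ", " y "⟫" => inner ℝ x y

theorem inner_prim_prim {f g : ℝ → H} (hf : Integrable f (muIoo a b))
    (hg : Integrable g (muIoo a b)) {t : ℝ} (ht : a ≤ t) :
    ⟪prim a b f t, prim a b g t⟫
      = prim a b (fun s => ⟪f s, prim a b g s⟫ + ⟪prim a b f s, g s⟫) t :=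
  bilin_prim_prim (innerSL ℝ) hf hg ht

/-- By symmetry the integrand is half the derivative of `⟪A F, F⟫`, where `F = prim a b f` vanishes
at `a`. -/
theorem prim_inner_symm {A : H →L[ℝ] H} (hA : ∀ x y, ⟪A x, y⟫ = ⟪x, A y⟫) {f : ℝ → H}
    (hf : MemLp f 2 (muIoo a b)) {t : ℝ} (ht : a ≤ t) :
    prim a b (fun s => ⟪A (prim a b f s), f s⟫) t
      = 1 / 2 * ⟪A (prim a b f t), prim a b f t⟫ := by
  have hi : Integrable f (muIoo a b) := hf.integrable (by norm_num)
  have h1 : Integrable (fun s => ⟪A (prim a b f s), f s⟫) (muIoo a b) :=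
    integrable_inner (A.comp_memLp' (memLp_prim hi)) hf
  have h := inner_prim_prim (A.integrable_comp hi) hi ht
  rw [prim_clm A hi] at h
  have e : (fun s => ⟪A (f s), prim a b f s⟫ + ⟪prim a b (fun s => A (f s)) s, f s⟫)
      = fun s => ⟪A (prim a b f s), f s⟫ + ⟪A (prim a b f s), f s⟫ := by
    funext s
    rw [prim_clm A hi, hA (f s), real_inner_comm]
  rw [e, prim_add h1 h1] at h
  linarith

/-- The pairing is half the quadratic form of `A` at the final value of the primitive. It gives the
sign of the terms with `ρ` and `r`, and the monotonicity of `V`. -/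
theorem inner_compLpL_volterra_nonneg (hab : a ≤ b) {A : H →L[ℝ] H}
    (hA : ∀ x y, ⟪A x, y⟫ = ⟪x, A y⟫) (hA0 : ∀ x, 0 ≤ ⟪A x, x⟫) (f : Lp H 2 (muIoo a b)) :
    0 ≤ ⟪A.compLpL 2 (muIoo a b) (volterra a b H f), f⟫ := by
  have : ⟪A.compLpL 2 (muIoo a b) (volterra a b H f), f⟫
      = prim a b (fun s => ⟪A (prim a b f s), f s⟫) b := by
    rw [prim_eq_integral hab, L2.inner_def]
    refine integral_congr_ae ?_
    filter_upwards [A.coeFn_compLpL (volterra a b H f), coeFn_volterra f] with t h1 h2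
    rw [h1, h2]
  rw [this, prim_inner_symm hA (Lp.memLp f) hab]
  have := hA0 (prim a b f b)
  positivity

theorem inner_volterra_nonneg (hab : a ≤ b) (f : Lp H 2 (muIoo a b)) :
    0 ≤ ⟪volterra a b H f, f⟫ := by
  have h := inner_compLpL_volterra_nonneg hab (A := ContinuousLinearMap.id ℝ H) (fun _ _ => rfl)
    (fun _ => real_inner_self_nonneg) f
  have e : (ContinuousLinearMap.id ℝ H).compLpL 2 (muIoo a b) (volterra a b H f)
      = volterra a b H f := Lp.ext (ContinuousLinearMap.coeFn_compLpL _ _)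
  rwa [e] at h

/-- In the expansion of `‖V y + ε y‖²` the cross term is nonnegative by monotonicity. -/
theorem norm_volterra_resolvent_le (hab : a ≤ b) {ε : ℝ} (hε : 0 < ε) (f : Lp H 2 (muIoo a b)) :
    ‖volterra a b H (volterraResolvent a b H ε f)‖ ≤ ‖f‖ := by
  have h := volterra_resolvent_add hab hε.ne' f
  set y := volterraResolvent a b H ε f
  have h1 := inner_volterra_nonneg hab y
  have h2 : ‖f‖ ^ 2 = ‖volterra a b H y‖ ^ 2 + 2 * (ε * ⟪volterra a b H y, y⟫) + ‖ε • y‖ ^ 2 := by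
    rw [← h, norm_add_sq_real, inner_smul_right]
  refine le_of_sq_le_sq ?_ (norm_nonneg _)
  have := mul_nonneg hε.le h1
  have := sq_nonneg ‖ε • y‖
  linarith

end HilbertValued

/-- The hypothesis says that `(∫ y + Γ) exp (-C t)` has nonpositive derivative. -/
theorem gronwall_integral {y : ℝ → ℝ} (hy : Continuous y) {C Γ T : ℝ} (hT : 0 ≤ T)
    (h : ∀ t ∈ Icc 0 T, y t ≤ C * ((∫ s in (0 : ℝ)..t, y s) + Γ)) :
    (∫ s in (0 : ℝ)..T, y s) + Γ ≤ Γ * Real.exp (C * T) := by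
  set φ : ℝ → ℝ := fun t => ((∫ s in (0 : ℝ)..t, y s) + Γ) * Real.exp (-(C * t)) with hφ
  have hd : ∀ t, HasDerivAt φ (y t * Real.exp (-(C * t))
      + ((∫ s in (0 : ℝ)..t, y s) + Γ) * (Real.exp (-(C * t)) * (-(C * 1)))) t := fun t =>
    (((hy.integral_hasStrictDerivAt 0 t).hasDerivAt).add_const Γ).mul
      (((hasDerivAt_id t).const_mul C).neg.exp)
  have hanti : AntitoneOn φ (Icc 0 T) := by
    refine antitoneOn_of_deriv_nonpos (convex_Icc 0 T)
      (fun t _ => (hd t).continuousAt.continuousWithinAt)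
      (fun t _ => (hd t).differentiableAt.differentiableWithinAt) fun t ht => ?_
    rw [(hd t).deriv]
    have h1 := h t (interior_subset ht)
    have h2 := Real.exp_pos (-(C * t))
    nlinarith
  have h1 := hanti (left_mem_Icc.2 hT) (right_mem_Icc.2 hT) hT
  simp only [hφ, intervalIntegral.integral_same, zero_add, mul_zero, Real.exp_zero,
    Real.exp_neg, inv_one, mul_one] at h1
  rwa [← div_eq_mul_inv, div_le_iff₀ (Real.exp_pos _)] at h1

/-! ### Energy estimate for the equation differentiated in time -/

section Evolution

variable {H : Type*} [NormedAddCommGroup H] [InnerProductSpace ℝ H] [CompleteSpace H]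

local notation "⟪" x ", " y "⟫" => inner ℝ x y

theorem mul_le_young {a b η : ℝ} (hη : 0 < η) : a * b ≤ η * b ^ 2 + a ^ 2 / (4 * η) := by
  have h : η * b ^ 2 + a ^ 2 / (4 * η) - a * b = (2 * η * b - a) ^ 2 / (4 * η) := by
    field_simp; ring
  have : 0 ≤ (2 * η * b - a) ^ 2 / (4 * η) := by positivity
  linarith

/-- The energy inequality, before Gronwall's lemma, for the abstract equation
`J* ρ J W' + N W + r ∫ W = ∫ G'` with zero initial data. -/
theorem energy_identity_le {T ρ₀ κ₀ : ℝ} {J ρ N r : H →L[ℝ] H}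
    (hρ : ∀ x, ρ₀ * ‖x‖ ^ 2 ≤ ⟪ρ x, x⟫)
    (hN : ∀ x y, ⟪N x, y⟫ = ⟪x, N y⟫) (hN0 : ∀ x, κ₀ * ‖x‖ ^ 2 ≤ ⟪N x, x⟫)
    {Z G' : ℝ → H} (hZ : MemLp Z 2 (muIoo 0 T)) (hG : MemLp G' 2 (muIoo 0 T))
    (heq : ∀ᵐ t ∂(muIoo 0 T), ∀ v : H, ⟪ρ (J (Z t)), J v⟫ + ⟪N (prim 0 T Z t), v⟫
      + ⟪r (prim 0 T (prim 0 T Z) t), v⟫ = ⟪prim 0 T G' t, v⟫) {t : ℝ} (ht : 0 ≤ t) :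
    ρ₀ * prim 0 T (fun s => ‖J (Z s)‖ ^ 2) t + κ₀ / 2 * ‖prim 0 T Z t‖ ^ 2
      ≤ ‖r‖ * ‖prim 0 T (prim 0 T Z) t‖ * ‖prim 0 T Z t‖
        + ‖r‖ * prim 0 T (fun s => ‖prim 0 T Z s‖ ^ 2) t
        + ‖prim 0 T G' t‖ * ‖prim 0 T Z t‖
        + prim 0 T (fun s => ‖G' s‖ * ‖prim 0 T Z s‖) t := by
  have iZ : Integrable Z (muIoo 0 T) := hZ.integrable (by norm_num)
  have iG : Integrable G' (muIoo 0 T) := hG.integrable (by norm_num)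
  set W := prim 0 T Z with hW
  have mW : MemLp W 2 (muIoo 0 T) := memLp_prim iZ
  have iW : Integrable W (muIoo 0 T) := mW.integrable (by norm_num)
  set V := prim 0 T W with hV
  have mV : MemLp V 2 (muIoo 0 T) := memLp_prim iW
  set G := prim 0 T G' with hGdef
  have mG : MemLp G 2 (muIoo 0 T) := memLp_prim iG
  have mJZ : MemLp (fun s => J (Z s)) 2 (muIoo 0 T) := J.comp_memLp' hZ
  have a1 : Integrable (fun s => ⟪ρ (J (Z s)), J (Z s)⟫) (muIoo 0 T) :=
    integrable_inner (ρ.comp_memLp' mJZ) mJZ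
  have a2 : Integrable (fun s => ⟪N (W s), Z s⟫) (muIoo 0 T) :=
    integrable_inner (N.comp_memLp' mW) hZ
  have a3 : Integrable (fun s => ⟪r (V s), Z s⟫) (muIoo 0 T) :=
    integrable_inner (r.comp_memLp' mV) hZ
  have a4 : Integrable (fun s => ⟪r (W s), W s⟫) (muIoo 0 T) :=
    integrable_inner (r.comp_memLp' mW) mW
  have a5 : Integrable (fun s => ⟪G s, Z s⟫) (muIoo 0 T) := integrable_inner mG hZ
  have a6 : Integrable (fun s => ⟪G' s, W s⟫) (muIoo 0 T) := integrable_inner hG mW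
  have a7 : Integrable (fun s => ‖J (Z s)‖ ^ 2) (muIoo 0 T) := mJZ.norm.integrable_sq
  have a8 : Integrable (fun s => ‖W s‖ ^ 2) (muIoo 0 T) := mW.norm.integrable_sq
  have a9 : Integrable (fun s => ‖G' s‖ * ‖W s‖) (muIoo 0 T) := hG.norm.integrable_mul mW.norm
  -- The test function is `Z = W'`, integrated over `(0, t)`.
  have e1 : prim 0 T (fun s => ⟪ρ (J (Z s)), J (Z s)⟫) t + prim 0 T (fun s => ⟪N (W s), Z s⟫) t
      + prim 0 T (fun s => ⟪r (V s), Z s⟫) t = prim 0 T (fun s => ⟪G s, Z s⟫) t := by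
    have a12 : Integrable (fun s => ⟪ρ (J (Z s)), J (Z s)⟫ + ⟪N (W s), Z s⟫) (muIoo 0 T) := a1.add a2
    rw [← prim_add a1 a2, ← prim_add a12 a3]
    refine congrFun (prim_congr ?_) t
    filter_upwards [heq] with s hs using hs _
  have e2 := prim_inner_symm hN hZ ht
  -- The stiffness and the forcing are paired with `Z`, which is not controlled; integration by
  -- parts moves the time derivative onto the other factor, leaving only `W` and its final value.
  have e3 : ⟪r (V t), W t⟫ = prim 0 T (fun s => ⟪r (W s), W s⟫) t
      + prim 0 T (fun s => ⟪r (V s), Z s⟫) t := by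
    rw [← prim_add a4 a3, hV, ← prim_clm r iW, hW, inner_prim_prim (r.integrable_comp iW) iZ ht]
    simp only [prim_clm r iW]
    rfl
  have e4 : ⟪G t, W t⟫ = prim 0 T (fun s => ⟪G' s, W s⟫) t + prim 0 T (fun s => ⟪G s, Z s⟫) t := by
    rw [← prim_add a6 a5]
    exact inner_prim_prim iG iZ ht
  have b1 : ρ₀ * prim 0 T (fun s => ‖J (Z s)‖ ^ 2) t
      ≤ prim 0 T (fun s => ⟪ρ (J (Z s)), J (Z s)⟫) t := by
    rw [← smul_eq_mul, ← prim_smul]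
    exact prim_mono (a7.const_mul _) a1 (Filter.Eventually.of_forall fun s => hρ _) ht
  have b2 : prim 0 T (fun s => ⟪r (W s), W s⟫) t ≤ ‖r‖ * prim 0 T (fun s => ‖W s‖ ^ 2) t := by
    rw [← smul_eq_mul, ← prim_smul]
    refine prim_mono a4 (a8.const_mul _) (Filter.Eventually.of_forall fun s => ?_) ht
    calc ⟪r (W s), W s⟫ ≤ ‖r (W s)‖ * ‖W s‖ := real_inner_le_norm _ _
      _ ≤ ‖r‖ * ‖W s‖ * ‖W s‖ := by gcongr; exact r.le_opNorm _
      _ = ‖r‖ * ‖W s‖ ^ 2 := by ring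
  have b3 : -prim 0 T (fun s => ⟪G' s, W s⟫) t ≤ prim 0 T (fun s => ‖G' s‖ * ‖W s‖) t := by
    rw [← neg_one_mul, ← smul_eq_mul, ← prim_smul]
    refine prim_mono (a6.const_mul _) a9 (Filter.Eventually.of_forall fun s => ?_) ht
    have := neg_le_of_abs_le (abs_real_inner_le_norm (G' s) (W s))
    linarith [smul_eq_mul (-1 : ℝ) ⟪G' s, W s⟫]
  have b4 : -⟪r (V t), W t⟫ ≤ ‖r‖ * ‖V t‖ * ‖W t‖ := by
    refine (neg_le_abs _).trans ((abs_real_inner_le_norm _ _).trans ?_)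
    gcongr
    exact r.le_opNorm _
  have b5 : ⟪G t, W t⟫ ≤ ‖G t‖ * ‖W t‖ := real_inner_le_norm _ _
  have b6 := hN0 (W t)
  linarith

/-- The a priori estimate for `J W'` in the abstract equation. -/
theorem energy_estimate {T ρ₀ κ₀ r₁ c Γ C : ℝ} (hT : 0 ≤ T) (hρ₀ : 0 < ρ₀) (hκ₀ : 0 < κ₀)
    (hc : 0 < c) {J ρ N r : H →L[ℝ] H}
    (hρ : ∀ x, ρ₀ * ‖x‖ ^ 2 ≤ ⟪ρ x, x⟫)
    (hN : ∀ x y, ⟪N x, y⟫ = ⟪x, N y⟫) (hN0 : ∀ x, κ₀ * ‖x‖ ^ 2 ≤ ⟪N x, x⟫) (hr : ‖r‖ ≤ r₁)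
    (hC1 : 4 * (c + 1) * (1 + T) / κ₀ ^ 2 ≤ C)
    (hC2 : 4 / κ₀ * (κ₀ * c / (4 * (c + 1)) + r₁ + T * r₁ ^ 2 * (c + 1) / κ₀) ≤ C)
    {Z G' : ℝ → H} (hZ : MemLp Z 2 (muIoo 0 T)) (hG : MemLp G' 2 (muIoo 0 T))
    (hΓ : ∫ t in Ioo 0 T, ‖G' t‖ ^ 2 ≤ c * Γ)
    (heq : ∀ᵐ t ∂(muIoo 0 T), ∀ v : H, ⟪ρ (J (Z t)), J v⟫ + ⟪N (prim 0 T Z t), v⟫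
      + ⟪r (prim 0 T (prim 0 T Z) t), v⟫ = ⟪prim 0 T G' t, v⟫) :
    ∫ t in Ioo 0 T, ‖J (Z t)‖ ^ 2 ≤ κ₀ / 2 * (C / (2 * ρ₀)) * Real.exp (C * T) * Γ := by
  have iZ : Integrable Z (muIoo 0 T) := hZ.integrable (by norm_num)
  have mW : MemLp (prim 0 T Z) 2 (muIoo 0 T) := memLp_prim iZ
  have hK : 0 < c + 1 := by linarith
  have hΓ0 : 0 ≤ Γ := by
    have : 0 ≤ ∫ t in Ioo 0 T, ‖G' t‖ ^ 2 := integral_nonneg fun _ => by positivity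
    exact nonneg_of_mul_nonneg_right (this.trans hΓ) hc
  have hr0 : 0 ≤ r₁ := (norm_nonneg r).trans hr
  have hC0 : 0 ≤ C := le_trans (by positivity) hC1
  -- The energy inequality multiplied by `4 / κ₀` after absorption, so that `‖W(t)‖²` has
  -- coefficient one for Gronwall's lemma.
  have main : ∀ t ∈ Icc 0 T, 4 * ρ₀ / κ₀ * prim 0 T (fun s => ‖J (Z s)‖ ^ 2) t
      + ‖prim 0 T Z t‖ ^ 2 ≤ C * (prim 0 T (fun s => ‖prim 0 T Z s‖ ^ 2) t + Γ) := by
    intro t ht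
    have h0 := energy_identity_le hρ hN hN0 hZ hG heq ht.1
    have hY0 : 0 ≤ prim 0 T (fun s => ‖prim 0 T Z s‖ ^ 2) t :=
      prim_nonneg (Filter.Eventually.of_forall fun _ => by positivity) ht.1
    have hGt : prim 0 T (fun s => ‖G' s‖ ^ 2) t ≤ c * Γ :=
      (prim_le_integral hG.norm.integrable_sq
        (Filter.Eventually.of_forall fun _ => by positivity) ht.1).trans hΓ
    have hV2 : ‖prim 0 T (prim 0 T Z) t‖ ^ 2
        ≤ T * prim 0 T (fun s => ‖prim 0 T Z s‖ ^ 2) t := by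
      calc ‖prim 0 T (prim 0 T Z) t‖ ^ 2 ≤ prim 0 T (fun s => ‖prim 0 T Z s‖) t ^ 2 := by
            gcongr; exact norm_prim_le_prim_norm ht.1
        _ ≤ (t - 0) * prim 0 T (fun s => ‖prim 0 T Z s‖ ^ 2) t := sq_prim_le mW.norm ht
        _ ≤ _ := by gcongr; linarith [ht.2]
    have hG2 : ‖prim 0 T G' t‖ ^ 2 ≤ T * (c * Γ) := by
      calc ‖prim 0 T G' t‖ ^ 2 ≤ prim 0 T (fun s => ‖G' s‖) t ^ 2 := by
            gcongr; exact norm_prim_le_prim_norm ht.1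
        _ ≤ (t - 0) * prim 0 T (fun s => ‖G' s‖ ^ 2) t := sq_prim_le hG.norm ht
        _ ≤ T * (c * Γ) := by
            refine mul_le_mul (by linarith [ht.2]) hGt ?_ hT
            exact prim_nonneg (Filter.Eventually.of_forall fun _ => by positivity) ht.1
    -- The Young weights at time `t`, `κ₀ / (4 (c + 1))` here and `κ₀ c / (4 (c + 1))` in `y2`, add
    -- up to `κ₀ / 4`, half of the available coercivity. The factor `c` in the forcing weights
    -- cancels the one in the bound `c * Γ`.
    have y1 : ‖r‖ * ‖prim 0 T (prim 0 T Z) t‖ * ‖prim 0 T Z t‖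
        ≤ κ₀ / (4 * (c + 1)) * ‖prim 0 T Z t‖ ^ 2
          + T * r₁ ^ 2 * (c + 1) / κ₀ * prim 0 T (fun s => ‖prim 0 T Z s‖ ^ 2) t := by
      refine (mul_le_young (η := κ₀ / (4 * (c + 1))) (by positivity)).trans ?_
      gcongr
      have : (‖r‖ * ‖prim 0 T (prim 0 T Z) t‖) ^ 2
          ≤ r₁ ^ 2 * (T * prim 0 T (fun s => ‖prim 0 T Z s‖ ^ 2) t) := by
        rw [mul_pow]; gcongr
      rw [div_le_iff₀ (by positivity)]
      refine this.trans_eq ?_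
      field_simp
    have y2 : ‖prim 0 T G' t‖ * ‖prim 0 T Z t‖
        ≤ κ₀ * c / (4 * (c + 1)) * ‖prim 0 T Z t‖ ^ 2 + T * (c + 1) / κ₀ * Γ := by
      refine (mul_le_young (η := κ₀ * c / (4 * (c + 1))) (by positivity)).trans ?_
      gcongr
      rw [div_le_iff₀ (by positivity)]
      refine hG2.trans_eq ?_
      field_simp
    have y3 : prim 0 T (fun s => ‖G' s‖ * ‖prim 0 T Z s‖) t
        ≤ κ₀ * c / (4 * (c + 1)) * prim 0 T (fun s => ‖prim 0 T Z s‖ ^ 2) t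
          + (c + 1) / κ₀ * Γ := by
      have i2 : Integrable (fun s => ((c + 1) / (κ₀ * c)) • ‖G' s‖ ^ 2) (muIoo 0 T) :=
        hG.norm.integrable_sq.const_mul _
      have i1 : Integrable (fun s => (κ₀ * c / (4 * (c + 1))) • ‖prim 0 T Z s‖ ^ 2) (muIoo 0 T) :=
        mW.norm.integrable_sq.const_mul _
      have i12 : Integrable (fun s => (κ₀ * c / (4 * (c + 1))) • ‖prim 0 T Z s‖ ^ 2
          + ((c + 1) / (κ₀ * c)) • ‖G' s‖ ^ 2) (muIoo 0 T) := i1.add i2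
      have h1 : prim 0 T (fun s => ‖G' s‖ * ‖prim 0 T Z s‖) t
          ≤ prim 0 T (fun s => (κ₀ * c / (4 * (c + 1))) • ‖prim 0 T Z s‖ ^ 2
            + ((c + 1) / (κ₀ * c)) • ‖G' s‖ ^ 2) t := by
        refine prim_mono (hG.norm.integrable_mul mW.norm) i12
          (Filter.Eventually.of_forall fun s => ?_) ht.1
        refine (mul_le_young (η := κ₀ * c / (4 * (c + 1))) (by positivity)).trans_eq ?_
        simp only [smul_eq_mul]
        field_simp
      rw [prim_add i1 i2, prim_smul, prim_smul] at h1
      refine h1.trans ?_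
      simp only [smul_eq_mul]
      have h2 : (c + 1) / (κ₀ * c) * prim 0 T (fun s => ‖G' s‖ ^ 2) t ≤ (c + 1) / κ₀ * Γ := by
        calc (c + 1) / (κ₀ * c) * prim 0 T (fun s => ‖G' s‖ ^ 2) t
            ≤ (c + 1) / (κ₀ * c) * (c * Γ) := by gcongr
          _ = (c + 1) / κ₀ * Γ := by field_simp
      linarith
    have y4 : ‖r‖ * prim 0 T (fun s => ‖prim 0 T Z s‖ ^ 2) t
        ≤ r₁ * prim 0 T (fun s => ‖prim 0 T Z s‖ ^ 2) t := by gcongr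
    set Y := prim 0 T (fun s => ‖prim 0 T Z s‖ ^ 2) t
    set X := prim 0 T (fun s => ‖J (Z s)‖ ^ 2) t
    set y := ‖prim 0 T Z t‖ ^ 2
    have hsum : κ₀ / (4 * (c + 1)) * y + κ₀ * c / (4 * (c + 1)) * y = κ₀ / 4 * y := by
      field_simp; ring
    have h5 : ρ₀ * X + κ₀ / 4 * y
        ≤ (κ₀ * c / (4 * (c + 1)) + r₁ + T * r₁ ^ 2 * (c + 1) / κ₀) * Y
          + (c + 1) * (1 + T) / κ₀ * Γ := by
      have : (c + 1) * (1 + T) / κ₀ * Γ = T * (c + 1) / κ₀ * Γ + (c + 1) / κ₀ * Γ := by ring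
      rw [this]
      linarith
    calc 4 * ρ₀ / κ₀ * X + y = 4 / κ₀ * (ρ₀ * X + κ₀ / 4 * y) := by field_simp
      _ ≤ 4 / κ₀ * ((κ₀ * c / (4 * (c + 1)) + r₁ + T * r₁ ^ 2 * (c + 1) / κ₀) * Y
          + (c + 1) * (1 + T) / κ₀ * Γ) := by gcongr
      _ = 4 / κ₀ * (κ₀ * c / (4 * (c + 1)) + r₁ + T * r₁ ^ 2 * (c + 1) / κ₀) * Y
          + 4 * (c + 1) * (1 + T) / κ₀ ^ 2 * Γ := by field_simp
      _ ≤ C * Y + C * Γ := by gcongr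
      _ = C * (Y + Γ) := by ring
  have hcont : Continuous fun s => ‖prim 0 T Z s‖ ^ 2 := (continuous_prim iZ).norm.pow 2
  have hgr := gronwall_integral hcont hT (C := C) (Γ := Γ) (fun t ht => by
    rw [← prim_eq_intervalIntegral (a := 0) (b := T) ht]
    have h1 : 0 ≤ prim 0 T (fun s => ‖J (Z s)‖ ^ 2) t :=
      prim_nonneg (Filter.Eventually.of_forall fun _ => by positivity) ht.1
    have h2 : 0 ≤ 4 * ρ₀ / κ₀ * prim 0 T (fun s => ‖J (Z s)‖ ^ 2) t := by positivity
    have := main t ht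
    linarith)
  rw [← prim_eq_intervalIntegral (a := 0) (b := T) (right_mem_Icc.2 hT)] at hgr
  have hend := main T (right_mem_Icc.2 hT)
  rw [prim_eq_integral hT] at hend
  have hy0 := sq_nonneg ‖prim 0 T Z T‖
  have h6 : 4 * ρ₀ / κ₀ * ∫ t in Ioo 0 T, ‖J (Z t)‖ ^ 2 ≤ C * (Γ * Real.exp (C * T)) := by
    have := mul_le_mul_of_nonneg_left hgr hC0
    linarith
  calc ∫ t in Ioo 0 T, ‖J (Z t)‖ ^ 2
      = κ₀ / (4 * ρ₀) * (4 * ρ₀ / κ₀ * ∫ t in Ioo 0 T, ‖J (Z t)‖ ^ 2) := by field_simp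
    _ ≤ κ₀ / (4 * ρ₀) * (C * (Γ * Real.exp (C * T))) := by gcongr
    _ = _ := by field_simp; ring

end Evolution

/-! ### Time regularity of the abstract equation -/

section AbstractRegularity

variable {H : Type*} [NormedAddCommGroup H] [InnerProductSpace ℝ H] {a b : ℝ}

local notation "⟪" x ", " y "⟫" => inner ℝ x y

theorem inner_compLpL_symm {A : H →L[ℝ] H} (hA : ∀ x y, ⟪A x, y⟫ = ⟪x, A y⟫)
    (f g : Lp H 2 (muIoo a b)) :
    ⟪A.compLpL 2 (muIoo a b) f, g⟫ = ⟪A.compLpL 2 (muIoo a b) g, f⟫ := by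
  rw [L2.inner_def, L2.inner_def]
  refine integral_congr_ae ?_
  filter_upwards [A.coeFn_compLpL f, A.coeFn_compLpL g] with t h1 h2
  rw [h1, h2, hA, real_inner_comm]

theorem mul_norm_sq_le_inner_compLpL {A : H →L[ℝ] H} {c : ℝ} (hA : ∀ x, c * ‖x‖ ^ 2 ≤ ⟪A x, x⟫)
    (f : Lp H 2 (muIoo a b)) : c * ‖f‖ ^ 2 ≤ ⟪A.compLpL 2 (muIoo a b) f, f⟫ := by
  rw [norm_sq_eq_integral, L2.inner_def, ← integral_const_mul]
  refine integral_mono_ae ((Lp.memLp f).norm.integrable_sq.const_mul _) (L2.integrable_inner _ _) ?_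
  filter_upwards [A.coeFn_compLpL f] with t h1
  rw [h1]
  exact hA _

variable [CompleteSpace H]

theorem inner_compLpL_adjoint (A : H →L[ℝ] H) (f g : Lp H 2 (muIoo a b)) :
    ⟪A.adjoint.compLpL 2 (muIoo a b) f, g⟫ = ⟪f, A.compLpL 2 (muIoo a b) g⟫ := by
  rw [L2.inner_def, L2.inner_def]
  refine integral_congr_ae ?_
  filter_upwards [A.adjoint.coeFn_compLpL f, A.coeFn_compLpL g] with t h1 h2
  rw [h1, h2, ContinuousLinearMap.adjoint_inner_left]

/-- Time regularity for the abstract equation `J* ρ q + N w + r V w = V (V f)`, `J w = V q`, where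
`V` is integration in time: `w` and `q` are integrals of square integrable functions. -/
theorem exists_time_derivatives {T ρ₀ κ₀ r₁ c Γ C : ℝ} (hT : 0 ≤ T) (hρ₀ : 0 < ρ₀)
    (hκ₀ : 0 < κ₀) (hc : 0 < c) {J ρ N r : H →L[ℝ] H}
    (hρ : ∀ x y, ⟪ρ x, y⟫ = ⟪x, ρ y⟫) (hρ0 : ∀ x, ρ₀ * ‖x‖ ^ 2 ≤ ⟪ρ x, x⟫)
    (hN : ∀ x y, ⟪N x, y⟫ = ⟪x, N y⟫) (hN0 : ∀ x, κ₀ * ‖x‖ ^ 2 ≤ ⟪N x, x⟫)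
    (hr : ∀ x y, ⟪r x, y⟫ = ⟪x, r y⟫) (hr0 : ∀ x, 0 ≤ ⟪r x, x⟫) (hr1 : ‖r‖ ≤ r₁)
    (hC1 : 4 * (c + 1) * (1 + T) / κ₀ ^ 2 ≤ C)
    (hC2 : 4 / κ₀ * (κ₀ * c / (4 * (c + 1)) + r₁ + T * r₁ ^ 2 * (c + 1) / κ₀) ≤ C)
    {w q f : Lp H 2 (muIoo 0 T)} (hf : ‖f‖ ^ 2 ≤ c * Γ)
    (hwq : J.compLpL 2 (muIoo 0 T) w = volterra 0 T H q)
    (heq : J.adjoint.compLpL 2 (muIoo 0 T) (ρ.compLpL 2 (muIoo 0 T) q)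
      + N.compLpL 2 (muIoo 0 T) w + r.compLpL 2 (muIoo 0 T) (volterra 0 T H w)
      = volterra 0 T H (volterra 0 T H f)) :
    ∃ z q' : Lp H 2 (muIoo 0 T), volterra 0 T H z = w ∧ J.compLpL 2 (muIoo 0 T) z = q ∧
      volterra 0 T H q' = q ∧
      ‖q'‖ ^ 2 ≤ κ₀ / 2 * (C / (2 * ρ₀)) * Real.exp (C * T) * Γ := by
  set V := volterra 0 T H with hV
  set D := volterraResolvent 0 T H with hD
  have hDV : ∀ ε > 0, ∀ x, D ε (V x) = V (D ε x) := fun ε hε => resolvent_volterra hT hε.ne'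
  have hDA : ∀ ε > 0, ∀ (A : H →L[ℝ] H) x, D ε (A.compLpL 2 (muIoo 0 T) x)
      = A.compLpL 2 (muIoo 0 T) (D ε x) := fun ε hε A => resolvent_compLpL hT hε.ne' A
  -- The resolvent commutes with every operator in the equation, so `D ε w`, `D ε q` and `D ε f`
  -- satisfy it exactly.
  have hDeq : ∀ ε > 0, J.adjoint.compLpL 2 (muIoo 0 T) (ρ.compLpL 2 (muIoo 0 T) (D ε q))
      + N.compLpL 2 (muIoo 0 T) (D ε w) + r.compLpL 2 (muIoo 0 T) (V (D ε w))
      = V (V (D ε f)) := by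
    intro ε hε
    have := congrArg (D ε) heq
    rwa [map_add, map_add, hDA ε hε, hDA ε hε, hDA ε hε, hDA ε hε, hDV ε hε, hDV ε hε,
      hDV ε hε] at this
  have hacc : ∀ x, 0 ≤ ⟪V x, x⟫ := inner_volterra_nonneg hT
  have hbound1 : ∀ ε > 0, ‖D ε w‖ ≤ ‖V f‖ / κ₀ := by
    intro ε hε
    have h1 : ⟪J.adjoint.compLpL 2 (muIoo 0 T) (ρ.compLpL 2 (muIoo 0 T) (D ε q)), D ε w⟫
        + ⟪N.compLpL 2 (muIoo 0 T) (D ε w), D ε w⟫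
        + ⟪r.compLpL 2 (muIoo 0 T) (V (D ε w)), D ε w⟫ = ⟪V (V (D ε f)), D ε w⟫ := by
      rw [← inner_add_left, ← inner_add_left, hDeq ε hε]
    -- Moving `J` across and using `J (D ε w) = V (D ε q)` turns this into the pairing of `ρ V (D ε
    -- q)` with `D ε q`, which is nonnegative.
    have h2 : 0 ≤ ⟪J.adjoint.compLpL 2 (muIoo 0 T) (ρ.compLpL 2 (muIoo 0 T) (D ε q)), D ε w⟫ := by
      rw [inner_compLpL_adjoint, ← hDA ε hε J, hwq, hDV ε hε, inner_compLpL_symm hρ]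
      refine inner_compLpL_volterra_nonneg hT hρ (fun x => le_trans (by positivity) (hρ0 x)) _
    have h3 := mul_norm_sq_le_inner_compLpL hN0 (D ε w)
    have h4 : 0 ≤ ⟪r.compLpL 2 (muIoo 0 T) (V (D ε w)), D ε w⟫ :=
      inner_compLpL_volterra_nonneg hT hr hr0 _
    have h5 : ⟪V (V (D ε f)), D ε w⟫ ≤ ‖V f‖ * ‖D ε w‖ := by
      refine (real_inner_le_norm _ _).trans ?_
      gcongr
      -- One of the two integrations pays for the resolvent, by `‖V (D ε y)‖ ≤ ‖y‖`; the other is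
      -- kept in `‖V f‖`.
      rw [← hDV ε hε f]
      exact norm_volterra_resolvent_le hT hε _
    rw [le_div_iff₀ hκ₀]
    rcases (norm_nonneg (D ε w)).eq_or_lt with h | h
    · rw [← h, zero_mul]; exact norm_nonneg _
    · refine le_of_mul_le_mul_right ?_ h
      linarith
  obtain ⟨z, hz, -⟩ := exists_of_resolvent_bounded hacc
    (fun ε hε => volterra_resolvent_add hT hε.ne' w) hbound1
  have hzq : J.compLpL 2 (muIoo 0 T) z = q := by
    apply volterra_injective (a := 0) (b := T)
    rw [← compLpL_volterra, ← hV, hz, hwq]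
  set M := κ₀ / 2 * (C / (2 * ρ₀)) * Real.exp (C * T) * Γ with hM
  have hbound2 : ∀ ε > 0, ‖D ε q‖ ^ 2 ≤ M := by
    intro ε hε
    have hnorm : ‖V (D ε f)‖ ^ 2 ≤ c * Γ :=
      le_trans (by gcongr; exact norm_volterra_resolvent_le hT hε f) hf
    rw [norm_sq_eq_integral] at hnorm
    have hq : D ε q = J.compLpL 2 (muIoo 0 T) (D ε z) := by rw [← hDA ε hε, hzq]
    have hint : ‖D ε q‖ ^ 2 = ∫ t in Ioo 0 T, ‖J (D ε z t)‖ ^ 2 := by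
      rw [hq, norm_sq_eq_integral]
      refine integral_congr_ae ?_
      filter_upwards [J.coeFn_compLpL (D ε z)] with t h1
      rw [h1]
    rw [hint]
    -- Here `Z = D ε z` and `G' = V (D ε f)`. Since `D ε w = V Z`, the equation has the form needed,
    -- and `‖G'‖ ≤ ‖f‖` uniformly in `ε`.
    refine energy_estimate hT hρ₀ hκ₀ hc hρ0 hN hN0 hr1 hC1 hC2 (Lp.memLp (D ε z))
      (Lp.memLp (V (D ε f))) hnorm ?_
    have e := hDeq ε hε
    rw [hq, ← hz, hDV ε hε] at e
    have e1 : V (D ε z) =ᵐ[muIoo 0 T] prim 0 T (D ε z) := coeFn_volterra _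
    have e2 : V (V (D ε z)) =ᵐ[muIoo 0 T] prim 0 T (prim 0 T (D ε z)) := by
      rw [← prim_congr e1]; exact coeFn_volterra _
    filter_upwards [e1, e2, coeFn_volterra (V (D ε f)), J.coeFn_compLpL (D ε z),
      ρ.coeFn_compLpL (J.compLpL 2 (muIoo 0 T) (D ε z)),
      J.adjoint.coeFn_compLpL (ρ.compLpL 2 (muIoo 0 T) (J.compLpL 2 (muIoo 0 T) (D ε z))),
      N.coeFn_compLpL (V (D ε z)), r.coeFn_compLpL (V (V (D ε z))),
      Lp.coeFn_add (J.adjoint.compLpL 2 (muIoo 0 T) (ρ.compLpL 2 (muIoo 0 T)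
        (J.compLpL 2 (muIoo 0 T) (D ε z))) + N.compLpL 2 (muIoo 0 T) (V (D ε z)))
        (r.compLpL 2 (muIoo 0 T) (V (V (D ε z)))),
      Lp.coeFn_add (J.adjoint.compLpL 2 (muIoo 0 T) (ρ.compLpL 2 (muIoo 0 T)
        (J.compLpL 2 (muIoo 0 T) (D ε z)))) (N.compLpL 2 (muIoo 0 T) (V (D ε z)))]
      with t t1 t2 t3 t4 t5 t6 t7 t8 t9 t10 v
    rw [← t1, ← t2, ← t3, ← ContinuousLinearMap.adjoint_inner_left, ← t4, ← t5, ← t6, ← t7, ← t8,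
      ← inner_add_left, ← inner_add_left, ← hV, ← e, t9, Pi.add_apply, t10, Pi.add_apply]
  obtain ⟨q', hq', hnq'⟩ := exists_of_resolvent_bounded hacc
    (fun ε hε => volterra_resolvent_add hT hε.ne' q)
    (fun ε hε => Real.le_sqrt_of_sq_le (hbound2 ε hε))
  refine ⟨z, q', hz, hzq, hq', ?_⟩
  have hM0 : 0 ≤ M := (sq_nonneg _).trans (hbound2 1 one_pos)
  calc ‖q'‖ ^ 2 ≤ √M ^ 2 := by gcongr
    _ = M := Real.sq_sqrt hM0

end AbstractRegularity

/-- The continuous representative is determined by the values on the open interval. -/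
theorem HasValueAt.eq_of_ae_eq {E : Type*} [NormedAddCommGroup E] {a b : ℝ}
    {f G : ℝ → E} {x : ℝ} {c : E}
    (h : HasValueAt a b f x c)
    (hab : a < b) (hx : x ∈ Icc a b) (hG : Continuous G) (hfG : f =ᵐ[muIoo a b] G) : G x = c := by
  obtain ⟨K, hK, hKf, rfl⟩ := h
  have h1 : K =ᵐ[volume.restrict (Icc a b)] G := by
    rw [← Measure.restrict_congr_set (Ioo_ae_eq_Icc (a := a) (b := b))]
    exact hKf.trans hfG
  exact (Measure.eqOn_Icc_of_ae_eq volume hab.ne h1 hK hG.continuousOn hx).symm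

/-! ### Weak derivatives and primitives -/

section WeakDerivative

variable {E F : Type*} [NormedAddCommGroup E] [NormedSpace ℝ E] [NormedAddCommGroup F]
  [NormedSpace ℝ F] {a b : ℝ}

theorem integrable_test_smul {φ : ℝ → ℝ} (hφ : Continuous φ) (hs : HasCompactSupport φ)
    {f : ℝ → E} (hf : Integrable f (muIoo a b)) :
    Integrable (fun t => φ t • f t) (muIoo a b) := by
  obtain ⟨C, hC⟩ := hs.exists_bound_of_continuous hφ
  exact hf.bdd_smul C hφ.aestronglyMeasurable (Filter.Eventually.of_forall hC)

theorem integrable_deriv_test_smul {φ : ℝ → ℝ} (hφ : ContDiff ℝ ∞ φ) (hs : HasCompactSupport φ)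
    {f : ℝ → E} (hf : Integrable f (muIoo a b)) :
    Integrable (fun t => deriv φ t • f t) (muIoo a b) :=
  integrable_test_smul (hφ.continuous_deriv (by norm_num)) hs.deriv hf

theorem HasWeakDerivOn.congr {f f' g g' : ℝ → E} (h : HasWeakDerivOn a b f f')
    (hfg : f =ᵐ[muIoo a b] g) (hfg' : f' =ᵐ[muIoo a b] g') : HasWeakDerivOn a b g g' := by
  intro φ h1 h2 h3
  have e1 : ∫ t in Ioo a b, deriv φ t • g t = ∫ t in Ioo a b, deriv φ t • f t := by
    refine integral_congr_ae ?_
    filter_upwards [hfg] with t ht using by rw [ht]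
  have e2 : ∫ t in Ioo a b, φ t • g' t = ∫ t in Ioo a b, φ t • f' t := by
    refine integral_congr_ae ?_
    filter_upwards [hfg'] with t ht using by rw [ht]
  rw [e1, e2, h φ h1 h2 h3]

theorem HasWeakDerivOn.add {f f' g g' : ℝ → E} (h : HasWeakDerivOn a b f f')
    (k : HasWeakDerivOn a b g g') (hf : Integrable f (muIoo a b)) (hf' : Integrable f' (muIoo a b))
    (hg : Integrable g (muIoo a b)) (hg' : Integrable g' (muIoo a b)) :
    HasWeakDerivOn a b (fun t => f t + g t) (fun t => f' t + g' t) := by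
  intro φ h1 h2 h3
  simp only [smul_add]
  rw [integral_add (integrable_deriv_test_smul h1 h2 hf) (integrable_deriv_test_smul h1 h2 hg),
    integral_add (integrable_test_smul h1.continuous h2 hf')
      (integrable_test_smul h1.continuous h2 hg'), h φ h1 h2 h3, k φ h1 h2 h3, neg_add]

theorem HasWeakDerivOn.const_smul {f f' : ℝ → E} (h : HasWeakDerivOn a b f f') (c : ℝ) :
    HasWeakDerivOn a b (fun t => c • f t) (fun t => c • f' t) := by
  intro φ h1 h2 h3
  simp only [smul_comm _ c]
  rw [integral_smul, integral_smul, h φ h1 h2 h3, smul_neg]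

theorem test_eq_zero {φ : ℝ → ℝ} (hs : tsupport φ ⊆ Ioo a b) {t : ℝ} (ht : t ∉ Ioo a b) :
    φ t = 0 :=
  image_eq_zero_of_notMem_tsupport fun h => ht (hs h)

theorem prim_deriv_test {φ : ℝ → ℝ} (h1 : ContDiff ℝ ∞ φ) (hs : tsupport φ ⊆ Ioo a b) {t : ℝ}
    (ht : t ∈ Icc a b) : prim a b (deriv φ) t = φ t := by
  rw [prim_eq_intervalIntegral ht, intervalIntegral.integral_deriv_eq_sub
    (fun x _ => (h1.differentiable (by norm_num)) x)
    ((h1.continuous_deriv (by norm_num)).intervalIntegrable _ _),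
    test_eq_zero hs (fun h => lt_irrefl _ h.1), sub_zero]

/-- A test function is the primitive of its derivative and vanishes at `b`, so the product formula
for primitives is the claim. -/
theorem hasWeakDerivOn_prim [CompleteSpace E] {f : ℝ → E} (hf : Integrable f (muIoo a b)) :
    HasWeakDerivOn a b (prim a b f) f := by
  intro φ h1 h2 h3
  by_cases hab : a ≤ b
  swap
  · rw [Ioo_eq_empty (fun h => hab h.le)]; simp
  have hd : Integrable (deriv φ) (muIoo a b) :=
    (memLp_of_continuous (h1.continuous_deriv (by norm_num)) 1).integrable le_rfl
  have h := bilin_prim_prim (ContinuousLinearMap.lsmul ℝ ℝ : ℝ →L[ℝ] E →L[ℝ] E) hd hf hab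
  simp only [ContinuousLinearMap.lsmul_apply] at h
  have e : prim a b (fun s => deriv φ s • prim a b f s + prim a b (deriv φ) s • f s)
      = prim a b (fun s => deriv φ s • prim a b f s + φ s • f s) := by
    refine prim_congr ?_
    filter_upwards [ae_mem_Ioo a b] with t ht
    rw [prim_deriv_test h1 h3 (Ioo_subset_Icc_self ht)]
  rw [prim_deriv_test h1 h3 (right_mem_Icc.2 hab), test_eq_zero h3 (fun h => lt_irrefl _ h.2),
    zero_smul, e, prim_eq_integral hab, integral_add
      (integrable_deriv_test_smul h1 h2 ((memLp_prim hf).integrable (by norm_num)))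
      (integrable_test_smul h1.continuous h2 hf)] at h
  exact eq_neg_of_add_eq_zero_left h.symm

theorem hasWeakDerivOn_const (c : E) [CompleteSpace E] :
    HasWeakDerivOn a b (fun _ => c) (fun _ => (0 : E)) := by
  intro φ h1 h2 h3
  by_cases hab : a ≤ b
  swap
  · rw [Ioo_eq_empty (fun h => hab h.le)]; simp
  have hd : Integrable (deriv φ) (muIoo a b) :=
    (memLp_of_continuous (h1.continuous_deriv (by norm_num)) 1).integrable le_rfl
  rw [integral_smul_const, ← prim_eq_integral hab, prim_deriv_test h1 h3 (right_mem_Icc.2 hab),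
    test_eq_zero h3 (fun h => lt_irrefl _ h.2)]
  simp

theorem ae_eq_zero_of_test [CompleteSpace E] {f : ℝ → E} (hf : Integrable f (muIoo a b))
    (h : ∀ φ : ℝ → ℝ, ContDiff ℝ ∞ φ → HasCompactSupport φ → tsupport φ ⊆ Ioo a b →
      ∫ t in Ioo a b, φ t • f t = 0) : ∀ᵐ t ∂(muIoo a b), f t = 0 := by
  have := isOpen_Ioo.ae_eq_zero_of_integral_contDiff_smul_eq_zero (μ := volume) (f := f)
    (U := Ioo a b) (IntegrableOn.locallyIntegrableOn hf) (fun φ h1 h2 h3 => by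
      rw [← h φ h1 h2 h3, setIntegral_eq_integral_of_forall_compl_eq_zero]
      intro t ht
      rw [test_eq_zero h3 ht, zero_smul])
  exact (ae_restrict_iff' measurableSet_Ioo).2 this

theorem HasWeakDerivOn.unique [CompleteSpace E] {f f' g' : ℝ → E} (h : HasWeakDerivOn a b f f')
    (k : HasWeakDerivOn a b f g') (hf' : Integrable f' (muIoo a b))
    (hg' : Integrable g' (muIoo a b)) : f' =ᵐ[muIoo a b] g' := by
  have : ∀ᵐ t ∂(muIoo a b), f' t - g' t = 0 := by
    refine ae_eq_zero_of_test (hf'.sub hg') fun φ h1 h2 h3 => ?_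
    simp only [smul_sub]
    rw [integral_sub (integrable_test_smul h1.continuous h2 hf')
      (integrable_test_smul h1.continuous h2 hg')]
    have e1 := h φ h1 h2 h3
    rw [k φ h1 h2 h3] at e1
    rw [neg_injective e1, sub_self]
  filter_upwards [this] with t ht using sub_eq_zero.1 ht

/-- The primitive from `a` vanishes before the support of `χ`, and also after it because the total
integral is zero. -/
theorem exists_test_primitive {χ : ℝ → ℝ} (h1 : ContDiff ℝ ∞ χ) (h2 : HasCompactSupport χ)
    (h3 : tsupport χ ⊆ Ioo a b) (h0 : ∫ t in Ioo a b, χ t = 0) (hab : a ≤ b) :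
    ∃ φ : ℝ → ℝ, ContDiff ℝ ∞ φ ∧ HasCompactSupport φ ∧ tsupport φ ⊆ Ioo a b ∧ deriv φ = χ := by
  by_cases hne : (tsupport χ).Nonempty
  swap
  · have hχ : χ = 0 := by rwa [not_nonempty_iff_eq_empty, tsupport_eq_empty_iff] at hne
    refine ⟨0, contDiff_const, HasCompactSupport.zero, by simp, ?_⟩
    rw [hχ]; exact deriv_zero
  have hK : IsCompact (tsupport χ) := h2
  set c := sInf (tsupport χ)
  set d := sSup (tsupport χ)
  have hc : c ∈ Ioo a b := h3 (hK.sInf_mem hne)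
  have hd : d ∈ Ioo a b := h3 (hK.sSup_mem hne)
  have hsub : ∀ t, χ t ≠ 0 → c ≤ t ∧ t ≤ d := fun t ht =>
    ⟨csInf_le hK.bddBelow (subset_tsupport _ ht), le_csSup hK.bddAbove (subset_tsupport _ ht)⟩
  have hder : ∀ t, HasDerivAt (fun t => ∫ s in a..t, χ s) (χ t) t := fun t =>
    (h1.continuous.integral_hasStrictDerivAt a t).hasDerivAt
  have hderiv : deriv (fun t => ∫ s in a..t, χ s) = χ := funext fun t => (hder t).deriv
  have hzero : ∀ t, t ∉ Icc c d → ∫ s in a..t, χ s = 0 := by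
    intro t ht
    by_cases htc : t < c
    · refine intervalIntegral.integral_zero_ae (Filter.Eventually.of_forall fun s hs => ?_)
      by_contra hne
      have := (hsub s hne).1
      have hs2 := hs.2
      rcases max_choice a t with h | h <;> rw [h] at hs2 <;> linarith [hc.1]
    · have htd : d < t := by
        by_contra hle
        exact ht ⟨not_lt.1 htc, not_lt.1 hle⟩
      have hi : ∀ x y, IntervalIntegrable χ volume x y := fun x y =>
        h1.continuous.intervalIntegrable x y
      rw [← intervalIntegral.integral_add_adjacent_intervals (hi a b) (hi b t)]
      rw [← prim_eq_intervalIntegral (right_mem_Icc.2 hab), prim_eq_integral hab, h0, zero_add]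
      refine intervalIntegral.integral_zero_ae (Filter.Eventually.of_forall fun s hs => ?_)
      by_contra hne
      have := (hsub s hne).2
      have hs1 := hs.1
      rcases min_choice b t with h | h <;> rw [h] at hs1 <;> linarith [hd.2]
  have hts : tsupport (fun t => ∫ s in a..t, χ s) ⊆ Icc c d := by
    refine closure_minimal (fun t ht => ?_) isClosed_Icc
    by_contra h
    exact ht (hzero t h)
  refine ⟨fun t => ∫ s in a..t, χ s, ?_, ?_, ?_, hderiv⟩
  · exact contDiff_infty_iff_deriv.2 ⟨fun t => (hder t).differentiableAt, by rwa [hderiv]⟩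
  · exact isCompact_Icc.of_isClosed_subset (isClosed_tsupport _) hts
  · exact hts.trans (Icc_subset_Ioo hc.1 hd.2)

/-- A function with zero weak derivative is a.e. constant. -/
theorem HasWeakDerivOn.exists_ae_eq_const [CompleteSpace E] {f : ℝ → E} (hab : a < b)
    (hf : Integrable f (muIoo a b)) (h : HasWeakDerivOn a b f (fun _ => 0)) :
    ∃ c : E, f =ᵐ[muIoo a b] fun _ => c := by
  -- A bump of mass one inside `(a, b)`. Subtracting `m * η` from a test function of mass `m` leaves
  -- mass zero, hence the derivative of a test function; the constant is the `η`-average of `f`.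
  let B : ContDiffBump ((a + b) / 2) := ⟨(b - a) / 4, (b - a) / 3, by linarith, by linarith⟩
  set η : ℝ → ℝ := B.normed volume
  have η1 : ContDiff ℝ ∞ η := B.contDiff_normed
  have η2 : HasCompactSupport η := B.hasCompactSupport_normed
  have η3 : tsupport η ⊆ Ioo a b := by
    rw [B.tsupport_normed_eq, Real.closedBall_eq_Icc]
    exact Icc_subset_Ioo (by simp only [B]; linarith) (by simp only [B]; linarith)
  have η4 : ∫ t in Ioo a b, η t = 1 := by
    rw [setIntegral_eq_integral_of_forall_compl_eq_zero fun t ht => test_eq_zero η3 ht]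
    exact B.integral_normed
  refine ⟨∫ t in Ioo a b, η t • f t, ?_⟩
  set c := ∫ t in Ioo a b, η t • f t
  have hi : Integrable (fun t => f t - c) (muIoo a b) := hf.sub (integrable_const c)
  have : ∀ᵐ t ∂(muIoo a b), f t - c = 0 := by
    refine ae_eq_zero_of_test hi fun ψ h1 h2 h3 => ?_
    have iψ : Integrable ψ (muIoo a b) := (memLp_of_continuous h1.continuous 1).integrable le_rfl
    have iη : Integrable η (muIoo a b) := (memLp_of_continuous η1.continuous 1).integrable le_rfl
    set m := ∫ t in Ioo a b, ψ t
    have mη1 : ContDiff ℝ ∞ (fun t => m * η t) := contDiff_const.mul η1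
    have mηs : tsupport (fun t => m * η t) ⊆ tsupport η := tsupport_mul_subset_right
    have hsupp : tsupport (fun t => ψ t - m * η t) ⊆ tsupport ψ ∪ tsupport η :=
      (tsupport_sub _ _).trans (union_subset_union_right _ mηs)
    obtain ⟨φ, p1, p2, p3, p4⟩ := exists_test_primitive (a := a) (b := b)
      (χ := fun t => ψ t - m * η t) (h1.sub mη1)
      ((h2.isCompact.union η2.isCompact).of_isClosed_subset (isClosed_tsupport _) hsupp)
      (hsupp.trans (union_subset h3 η3))
      (by rw [integral_sub iψ (iη.const_mul m), integral_const_mul, η4, mul_one, sub_self]) hab.le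
    have key := h φ p1 p2 p3
    simp only [p4, smul_zero, integral_zero, neg_zero, sub_smul, mul_smul] at key
    have iηf : Integrable (fun t => m • η t • f t) (muIoo a b) :=
      (integrable_test_smul η1.continuous η2 hf).smul m
    rw [integral_sub (integrable_test_smul h1.continuous h2 hf) iηf, integral_smul] at key
    simp only [smul_sub]
    rw [integral_sub (integrable_test_smul h1.continuous h2 hf) (iψ.smul_const c),
      integral_smul_const]
    exact key
  filter_upwards [this] with t ht using sub_eq_zero.1 ht

theorem HasWeakDerivOn.exists_eq_add_prim [CompleteSpace E] {f f' : ℝ → E} (hab : a < b)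
    (h : HasWeakDerivOn a b f f') (hf : Integrable f (muIoo a b))
    (hf' : Integrable f' (muIoo a b)) :
    ∃ c : E, f =ᵐ[muIoo a b] fun t => c + prim a b f' t := by
  have hp : Integrable (prim a b f') (muIoo a b) := (memLp_prim hf').integrable (by norm_num)
  have h0 := h.add ((hasWeakDerivOn_prim hf').const_smul (-1)) hf hf' (hp.smul (-1 : ℝ))
    (hf'.smul (-1 : ℝ))
  have h1 : HasWeakDerivOn a b (fun t => f t + (-1 : ℝ) • prim a b f' t) (fun _ => (0 : E)) :=
    h0.congr (Filter.EventuallyEq.refl _ _) (Filter.Eventually.of_forall fun t => by simp)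
  obtain ⟨c, hc⟩ := h1.exists_ae_eq_const hab (hf.add (hp.smul (-1 : ℝ)))
  refine ⟨c, ?_⟩
  filter_upwards [hc] with t ht
  rw [← ht]; simp

theorem hasWeakDerivOn_add_prim [CompleteSpace E] {f : ℝ → E} (hf : Integrable f (muIoo a b))
    (c : E) : HasWeakDerivOn a b (fun t => c + prim a b f t) f := by
  have hp : Integrable (prim a b f) (muIoo a b) := (memLp_prim hf).integrable (by norm_num)
  refine ((hasWeakDerivOn_const c).add (hasWeakDerivOn_prim hf) (integrable_const _)
    (integrable_zero _ _ _) hp hf).congr (Filter.EventuallyEq.refl _ _) ?_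
  exact Filter.Eventually.of_forall fun t => zero_add _

theorem HasWeakDerivOn.eq_prim_of_hasValueAt [CompleteSpace E] {f f' : ℝ → E} (hab : a < b)
    (h : HasWeakDerivOn a b f f') (hf : Integrable f (muIoo a b))
    (hf' : Integrable f' (muIoo a b)) (h0 : HasValueAt a b f a 0) :
    f =ᵐ[muIoo a b] prim a b f' := by
  obtain ⟨c, hc⟩ := h.exists_eq_add_prim hab hf hf'
  have := h0.eq_of_ae_eq hab (left_mem_Icc.2 hab.le) (continuous_const.add (continuous_prim hf')) hc
  simp only [Pi.add_apply, prim_self, add_zero] at this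
  simpa [this] using hc

theorem hasValueAt_prim {f g : ℝ → E} (hf : Integrable f (muIoo a b))
    (h : g =ᵐ[muIoo a b] prim a b f) (x : ℝ) : HasValueAt a b g x (prim a b f x) :=
  ⟨prim a b f, (continuous_prim hf).continuousOn, h.symm, rfl⟩

end WeakDerivative

/-! ### Completeness and components of Sobolev spaces -/

section SobolevSpace

variable {k : ℕ} {a b : ℝ} {X : Type*} [NormedAddCommGroup X] [NormedSpace ℝ X]

/-- The weak derivative of order `j` as a bounded operator. -/
def Sobolev.DL (j : Fin (k + 1)) : Sobolev k a b →L[ℝ] L2 a b :=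
  (PiLp.proj (𝕜 := ℝ) 2 (fun _ : Fin (k + 1) => L2 a b) j) ∘L (sobolevSubmodule k a b).subtypeL

@[simp] theorem Sobolev.DL_apply (j : Fin (k + 1)) (F : Sobolev k a b) : Sobolev.DL j F = F.D j :=
  rfl

theorem Sobolev.hasWeakDerivOn (F : Sobolev k a b) (i : Fin k) :
    HasWeakDerivOn a b (F.D i.castSucc) (F.D i.succ) := F.2 i

theorem Sobolev.norm_D_le (F : Sobolev k a b) (j : Fin (k + 1)) : ‖F.D j‖ ≤ ‖F‖ :=
  PiLp.norm_apply_le (p := 2) F.1 j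

theorem Sobolev.ext_D {F G : Sobolev k a b} (h : ∀ j, F.D j = G.D j) : F = G :=
  Subtype.ext (PiLp.ext h)

/-- An element of `H^k` is determined by its underlying function. -/
theorem Sobolev.ext {F G : Sobolev k a b} (h : F.D 0 = G.D 0) : F = G := by
  refine Sobolev.ext_D fun j => ?_
  induction j using Fin.induction with
  | zero => exact h
  | succ i ih =>
    have h1 := F.hasWeakDerivOn i
    rw [ih] at h1
    exact Lp.ext (h1.unique (G.hasWeakDerivOn i) (integrable_of_Lp _) (integrable_of_Lp _))

/-- A bounded operator into `H^k` from its components. -/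
def Sobolev.lift (A : Fin (k + 1) → X →L[ℝ] L2 a b)
    (hA : ∀ x (i : Fin k), HasWeakDerivOn a b (A i.castSucc x) (A i.succ x)) :
    X →L[ℝ] Sobolev k a b :=
  (((PiLp.continuousLinearEquiv 2 ℝ (fun _ : Fin (k + 1) => L2 a b)).symm :
    (Fin (k + 1) → L2 a b) →L[ℝ] PiLp 2 (fun _ : Fin (k + 1) => L2 a b)) ∘L
      ContinuousLinearMap.pi A).codRestrict (sobolevSubmodule k a b) hA

/-- An element of `H^k` from its components. -/
def Sobolev.mk' (A : Fin (k + 1) → L2 a b)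
    (hA : ∀ i : Fin k, HasWeakDerivOn a b (A i.castSucc) (A i.succ)) : Sobolev k a b :=
  ⟨WithLp.toLp 2 A, hA⟩

theorem continuous_integral_smul_L2 {φ : ℝ → ℝ} (hφ : Continuous φ) :
    Continuous fun f : L2 a b => ∫ t in Ioo a b, φ t • f t := by
  have h : ∀ f : L2 a b, ∫ t in Ioo a b, φ t • f t
      = inner ℝ ((memLp_of_continuous hφ 2).toLp φ : L2 a b) f := by
    intro f
    rw [L2.inner_def]
    refine integral_congr_ae ?_
    filter_upwards [(memLp_of_continuous (a := a) (b := b) hφ 2).coeFn_toLp] with t ht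
    rw [ht, real_inner_comm]
    simp
  simp only [h]
  fun_prop

/-- Each test function imposes an equality of two continuous functionals. Completeness follows;
Volterra equations with values in `H²` and the closed graph theorem rely on it. -/
theorem isClosed_sobolevSubmodule :
    IsClosed (sobolevSubmodule k a b : Set (PiLp 2 (fun _ : Fin (k + 1) => L2 a b))) := by
  have : (sobolevSubmodule k a b : Set (PiLp 2 (fun _ : Fin (k + 1) => L2 a b)))
      = ⋂ (i : Fin k) (φ : ℝ → ℝ) (_ : ContDiff ℝ ∞ φ) (_ : HasCompactSupport φ)
        (_ : tsupport φ ⊆ Ioo a b), {F | ∫ t in Ioo a b, deriv φ t • F i.castSucc t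
          = - ∫ t in Ioo a b, φ t • F i.succ t} := by
    ext F
    simp only [mem_iInter]
    rfl
  rw [this]
  refine isClosed_iInter fun i => isClosed_iInter fun φ => isClosed_iInter fun h1 =>
    isClosed_iInter fun _ => isClosed_iInter fun _ => isClosed_eq ?_ ?_
  · exact (continuous_integral_smul_L2 (h1.continuous_deriv (by norm_num))).comp
      (PiLp.continuous_apply 2 _ i.castSucc)
  · exact ((continuous_integral_smul_L2 h1.continuous).comp
      (PiLp.continuous_apply 2 _ i.succ)).neg

instance : CompleteSpace (Sobolev k a b) :=
  (isClosed_sobolevSubmodule (k := k) (a := a) (b := b)).completeSpace_coe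

end SobolevSpace

/-! ### Multiplication operators -/

section Multiplication

variable {a b : ℝ} {p q : ℝ → ℝ}

theorem ae_le_essSup_norm (hp : MemLp p ⊤ (muIoo a b)) :
    ∀ᵐ t ∂(muIoo a b), ‖p t‖ ≤ (eLpNorm p ⊤ (muIoo a b)).toReal := by
  have h := enorm_ae_le_eLpNormEssSup p (muIoo a b)
  filter_upwards [h] with t ht
  rw [← eLpNorm_exponent_top] at ht
  rw [← toReal_enorm]
  exact ENNReal.toReal_mono hp.2.ne ht

theorem memLp_mul (hp : MemLp p ⊤ (muIoo a b)) (f : L2 a b) :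
    MemLp (fun t => p t * f t) 2 (muIoo a b) := by
  refine MemLp.of_le_mul (Lp.memLp f) (hp.1.mul (Lp.memLp f).1)
    (c := (eLpNorm p ⊤ (muIoo a b)).toReal) ?_
  filter_upwards [ae_le_essSup_norm hp] with t ht
  rw [norm_mul]
  exact mul_le_mul_of_nonneg_right ht (norm_nonneg _)

/-- Multiplication by a bounded function, as an operator on `L²(a, b)`. -/
def mulOp (hp : MemLp p ⊤ (muIoo a b)) : L2 a b →L[ℝ] L2 a b :=
  LinearMap.mkContinuous
    { toFun := fun f => (memLp_mul hp f).toLp _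
      map_add' := fun f g => by
        rw [← MemLp.toLp_add]
        refine MemLp.toLp_congr _ _ ?_
        filter_upwards [Lp.coeFn_add f g] with t h
        rw [h, Pi.add_apply, Pi.add_apply, mul_add]
      map_smul' := fun c f => by
        rw [RingHom.id_apply, ← MemLp.toLp_const_smul]
        refine MemLp.toLp_congr _ _ ?_
        filter_upwards [Lp.coeFn_smul c f] with t h
        rw [h, Pi.smul_apply, Pi.smul_apply, smul_eq_mul, smul_eq_mul, mul_left_comm] }
    (eLpNorm p ⊤ (muIoo a b)).toReal (fun f => by
      refine Lp.norm_le_mul_norm_of_ae_le_mul ?_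
      filter_upwards [ae_le_essSup_norm hp, (memLp_mul hp f).coeFn_toLp] with t h1 h2
      simp only [LinearMap.coe_mk, AddHom.coe_mk, h2, norm_mul]
      exact mul_le_mul_of_nonneg_right h1 (norm_nonneg _))

theorem coeFn_mulOp (hp : MemLp p ⊤ (muIoo a b)) (f : L2 a b) :
    mulOp hp f =ᵐ[muIoo a b] fun t => p t * f t :=
  (memLp_mul hp f).coeFn_toLp

theorem inner_mulOp (hp : MemLp p ⊤ (muIoo a b)) (f g : L2 a b) :
    inner ℝ (mulOp hp f) g = ∫ t in Ioo a b, p t * f t * g t := by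
  rw [L2.inner_def]
  refine integral_congr_ae ?_
  filter_upwards [coeFn_mulOp hp f] with t h1
  rw [h1]
  simp [mul_comm]

theorem mulOp_symm (hp : MemLp p ⊤ (muIoo a b)) (f g : L2 a b) :
    inner ℝ (mulOp hp f) g = inner ℝ f (mulOp hp g) := by
  rw [real_inner_comm (mulOp hp g), inner_mulOp, inner_mulOp]
  refine integral_congr_ae (Filter.Eventually.of_forall fun t => ?_)
  simp only
  ring

theorem integrable_mulOp_mul (hp : MemLp p ⊤ (muIoo a b)) (f g : L2 a b) :
    Integrable (fun t => p t * f t * g t) (muIoo a b) := by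
  refine (L2.integrable_inner (𝕜 := ℝ) (mulOp hp f) g).congr ?_
  filter_upwards [coeFn_mulOp hp f] with t h1
  rw [h1]
  simp [mul_comm]

theorem mul_norm_sq_le_inner_mulOp (hp : MemLp p ⊤ (muIoo a b)) {c : ℝ}
    (h : ∀ᵐ t ∂(muIoo a b), c ≤ p t) (f : L2 a b) : c * ‖f‖ ^ 2 ≤ inner ℝ (mulOp hp f) f := by
  rw [inner_mulOp, norm_sq_eq_integral, ← integral_const_mul]
  refine integral_mono_ae ((Lp.memLp f).norm.integrable_sq.const_mul _)
    (integrable_mulOp_mul hp f f) ?_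
  filter_upwards [h] with t ht
  rw [Real.norm_eq_abs, sq_abs, mul_assoc, ← sq]
  exact mul_le_mul_of_nonneg_right ht (sq_nonneg _)

theorem norm_mulOp_le (hp : MemLp p ⊤ (muIoo a b)) {c : ℝ} (hc : 0 ≤ c)
    (h : ∀ᵐ t ∂(muIoo a b), |p t| ≤ c) : ‖mulOp hp‖ ≤ c := by
  refine ContinuousLinearMap.opNorm_le_bound _ hc fun f => ?_
  refine Lp.norm_le_mul_norm_of_ae_le_mul ?_
  filter_upwards [h, coeFn_mulOp hp f] with t h1 h2
  rw [h2, norm_mul]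
  exact mul_le_mul_of_nonneg_right h1 (norm_nonneg _)

theorem mulOp_comp_of_mul_eq_one (hp : MemLp p ⊤ (muIoo a b)) (hq : MemLp q ⊤ (muIoo a b))
    (h : ∀ᵐ t ∂(muIoo a b), p t * q t = 1) (f : L2 a b) : mulOp hp (mulOp hq f) = f := by
  apply Lp.ext
  filter_upwards [h, coeFn_mulOp hp (mulOp hq f), coeFn_mulOp hq f] with t h1 h2 h3
  rw [h2, h3, ← mul_assoc, h1, one_mul]

end Multiplication

/-! ### The adjoint of integration -/

section Integration

variable {a b : ℝ}

/-- The constant function `1` in `L²(a, b)`. -/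
def oneL2 (a b : ℝ) : L2 a b := (memLp_const (1 : ℝ)).toLp fun _ => (1 : ℝ)

theorem coeFn_oneL2 : oneL2 a b =ᵐ[muIoo a b] fun _ => (1 : ℝ) := (memLp_const 1).coeFn_toLp

theorem inner_oneL2 (f : L2 a b) : inner ℝ (oneL2 a b) f = ∫ t in Ioo a b, f t := by
  rw [L2.inner_def]
  refine integral_congr_ae ?_
  filter_upwards [coeFn_oneL2 (a := a) (b := b)] with t h
  rw [h]; simp

theorem prim_mul_prim {f g : ℝ → ℝ} (hf : Integrable f (muIoo a b))
    (hg : Integrable g (muIoo a b)) {t : ℝ} (ht : a ≤ t) :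
    prim a b f t * prim a b g t
      = prim a b (fun s => f s * prim a b g s + prim a b f s * g s) t :=
  bilin_prim_prim (ContinuousLinearMap.mul ℝ ℝ) hf hg ht

/-- Integration by parts: the adjoint is integration from the right end, total integral minus
integral from the left. -/
theorem adjoint_volterra (hab : a ≤ b) (f : L2 a b) :
    (volterra a b ℝ).adjoint f = inner ℝ (oneL2 a b) f • oneL2 a b - volterra a b ℝ f := by
  refine ext_inner_right ℝ fun g => ?_
  rw [ContinuousLinearMap.adjoint_inner_left, inner_sub_left, real_inner_smul_left, inner_oneL2,
    inner_oneL2, ← prim_eq_integral hab, ← prim_eq_integral hab,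
    prim_mul_prim (integrable_of_Lp f) (integrable_of_Lp g) hab]
  have i1 : Integrable (fun s => f s * prim a b g s) (muIoo a b) :=
    (Lp.memLp f).integrable_mul (memLp_prim (integrable_of_Lp g))
  have i2 : Integrable (fun s => prim a b f s * g s) (muIoo a b) :=
    (memLp_prim (integrable_of_Lp f)).integrable_mul (Lp.memLp g)
  rw [prim_add i1 i2]
  have e1 : inner ℝ f (volterra a b ℝ g) = prim a b (fun s => f s * prim a b g s) b := by
    rw [prim_eq_integral hab, L2.inner_def]
    refine integral_congr_ae ?_
    filter_upwards [coeFn_volterra g] with t h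
    rw [h]; simp [mul_comm]
  have e2 : inner ℝ (volterra a b ℝ f) g = prim a b (fun s => prim a b f s * g s) b := by
    rw [prim_eq_integral hab, L2.inner_def]
    refine integral_congr_ae ?_
    filter_upwards [coeFn_volterra f] with t h
    rw [h]; simp [mul_comm]
  rw [e1, e2]; ring

theorem hasWeakDerivOn_volterra (f : L2 a b) : HasWeakDerivOn a b (volterra a b ℝ f) f :=
  (hasWeakDerivOn_prim (integrable_of_Lp f)).congr (coeFn_volterra f).symm
    (Filter.EventuallyEq.refl _ _)

theorem hasWeakDerivOn_adjoint_volterra (hab : a ≤ b) (f : L2 a b) :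
    HasWeakDerivOn a b ((volterra a b ℝ).adjoint f) (-f : L2 a b) := by
  refine (hasWeakDerivOn_add_prim (integrable_of_Lp (-f)) (inner ℝ (oneL2 a b) f)).congr ?_
    (Filter.EventuallyEq.refl _ _)
  rw [adjoint_volterra hab, sub_eq_add_neg, ← map_neg]
  filter_upwards [Lp.coeFn_add (inner ℝ (oneL2 a b) f • oneL2 a b) (volterra a b ℝ (-f)),
    Lp.coeFn_smul (inner ℝ (oneL2 a b) f) (oneL2 a b), coeFn_oneL2 (a := a) (b := b),
    coeFn_volterra (-f)] with t h1 h2 h3 h4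
  rw [h1, Pi.add_apply, h2, Pi.smul_apply, h3, h4, smul_eq_mul, mul_one]

/-- The adjoint sends `1` to `b - t`. On `(0, ℓ)` this is the source of `ℓ³ / 3` in the final
constant. -/
theorem norm_sq_adjoint_volterra_one (hab : a ≤ b) :
    ‖(volterra a b ℝ).adjoint (oneL2 a b)‖ ^ 2 = (b - a) ^ 3 / 3 := by
  have h : (volterra a b ℝ).adjoint (oneL2 a b) =ᵐ[muIoo a b] fun t => b - t := by
    rw [adjoint_volterra hab]
    filter_upwards [Lp.coeFn_sub (inner ℝ (oneL2 a b) (oneL2 a b) • oneL2 a b)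
      (volterra a b ℝ (oneL2 a b)), Lp.coeFn_smul (inner ℝ (oneL2 a b) (oneL2 a b)) (oneL2 a b),
      coeFn_oneL2 (a := a) (b := b), coeFn_volterra (oneL2 a b), ae_mem_Ioo a b]
      with t h1 h2 h3 h4 h5
    rw [h1, Pi.sub_apply, h2, Pi.smul_apply, h3, h4, inner_oneL2, ← prim_eq_integral hab,
      prim_congr coeFn_oneL2, prim_const (right_mem_Icc.2 hab),
      prim_const (Ioo_subset_Icc_self h5)]
    simp
  rw [norm_sq_eq_integral, integral_congr_ae (g := fun t => (b - t) ^ 2)]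
  · rw [← prim_eq_integral hab, prim_eq_intervalIntegral (right_mem_Icc.2 hab),
      intervalIntegral.integral_comp_sub_left (fun t => t ^ 2) b, integral_pow]
    norm_num
  · filter_upwards [h] with t ht
    rw [ht, Real.norm_eq_abs, sq_abs]

end Integration

/-! ### Reduction to an equation for the second space derivative -/

section Clamped

variable {ℓ T : ℝ}

/-- The weak derivative of order `j` as a bounded operator. -/
def ClampedH2.DL (j : Fin 3) : ClampedH2 ℓ →L[ℝ] L2 0 ℓ :=
  (Sobolev.DL j) ∘L (clampedSubmodule ℓ).subtypeL

theorem eq_volterra_of_hasWeakDerivOn (hℓ : 0 < ℓ) {f f' : L2 0 ℓ} (h : HasWeakDerivOn 0 ℓ f f')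
    (h0 : HasValueAt 0 ℓ f 0 0) : f = volterra 0 ℓ ℝ f' :=
  Lp.ext ((h.eq_prim_of_hasValueAt hℓ (integrable_of_Lp f) (integrable_of_Lp f') h0).trans
    (coeFn_volterra f').symm)

/-- Integrating twice from the left end point. -/
def doubleVolterra (ℓ : ℝ) : L2 0 ℓ →L[ℝ] L2 0 ℓ := volterra 0 ℓ ℝ ∘L volterra 0 ℓ ℝ

theorem ClampedH2.D_one_eq (hℓ : 0 < ℓ) (v : ClampedH2 ℓ) : v.D 1 = volterra 0 ℓ ℝ (v.D 2) :=
  eq_volterra_of_hasWeakDerivOn hℓ (v.1.hasWeakDerivOn 1) v.2.2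

/-- Both integration constants vanish at the clamped end. -/
theorem ClampedH2.D_zero_eq (hℓ : 0 < ℓ) (v : ClampedH2 ℓ) :
    v.D 0 = doubleVolterra ℓ (v.D 2) := by
  rw [doubleVolterra, ContinuousLinearMap.comp_apply, ← v.D_one_eq hℓ]
  exact eq_volterra_of_hasWeakDerivOn hℓ (v.1.hasWeakDerivOn 0) v.2.1

theorem doubleVolterra_injective : Function.Injective (doubleVolterra ℓ) :=
  volterra_injective.comp volterra_injective

theorem hasValueAt_volterra {a b : ℝ} (f : L2 a b) (x : ℝ) :
    HasValueAt a b (volterra a b ℝ f) x (prim a b f x) :=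
  hasValueAt_prim (integrable_of_Lp f) (coeFn_volterra f) x

/-- The clamped function with a given second derivative. -/
def clampedOfSecondDeriv (ℓ : ℝ) : L2 0 ℓ →L[ℝ] ClampedH2 ℓ :=
  (Sobolev.lift (k := 2)
    ![doubleVolterra ℓ, volterra 0 ℓ ℝ, ContinuousLinearMap.id ℝ (L2 0 ℓ)]
    (fun h i => by
      fin_cases i
      · exact hasWeakDerivOn_volterra (volterra 0 ℓ ℝ h)
      · exact hasWeakDerivOn_volterra h)).codRestrict (clampedSubmodule ℓ) (fun h => by
        have h1 := hasValueAt_volterra (volterra 0 ℓ ℝ h) 0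
        have h2 := hasValueAt_volterra h 0
        rw [prim_self] at h1 h2
        exact ⟨h1, h2⟩)

theorem D_zero_clampedOfSecondDeriv (h : L2 0 ℓ) :
    (clampedOfSecondDeriv ℓ h).D 0 = doubleVolterra ℓ h := rfl

theorem D_two_clampedOfSecondDeriv (h : L2 0 ℓ) : (clampedOfSecondDeriv ℓ h).D 2 = h := rfl

/-- The representer `x ↦ ℓ - x` of the end point value in terms of the second derivative. -/
def tipFunctional (ℓ : ℝ) : L2 0 ℓ := (volterra 0 ℓ ℝ).adjoint (oneL2 0 ℓ)

/-- By parts, `v(ℓ) = ∫ (ℓ - x) v_xx`; the boundary load thus becomes an inner product with `v_xx`.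
-/
theorem hasValueAt_tip (hℓ : 0 ≤ ℓ) (h : L2 0 ℓ) :
    HasValueAt 0 ℓ ((clampedOfSecondDeriv ℓ h).D 0) ℓ (inner ℝ (tipFunctional ℓ) h) := by
  have e : inner ℝ (tipFunctional ℓ) h = prim 0 ℓ (volterra 0 ℓ ℝ h) ℓ := by
    rw [tipFunctional, ContinuousLinearMap.adjoint_inner_left, inner_oneL2, prim_eq_integral hℓ]
  rw [e]
  exact hasValueAt_volterra (volterra 0 ℓ ℝ h) ℓ

theorem compLpL_injective {E F : Type*} [NormedAddCommGroup E] [NormedSpace ℝ E]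
    [NormedAddCommGroup F] [NormedSpace ℝ F] {μ : Measure ℝ} {A : E →L[ℝ] F}
    (hA : Function.Injective A) : Function.Injective (A.compLpL 2 μ) := by
  intro f g h
  apply Lp.ext
  filter_upwards [A.coeFn_compLpL f, A.coeFn_compLpL g] with t h1 h2
  apply hA
  rw [← h1, ← h2, h]

/-- A square integrable function with zero initial value is the integral of its weak derivative. -/
theorem eq_volterra_of_memLp {E : Type*} [NormedAddCommGroup E] [NormedSpace ℝ E]
    [CompleteSpace E] (hT : 0 < T) {f f' : ℝ → E} {F F' : Lp E 2 (muIoo 0 T)}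
    (hF : F =ᵐ[muIoo 0 T] f) (hF' : F' =ᵐ[muIoo 0 T] f') (h : HasWeakDerivOn 0 T f f')
    (h0 : HasValueAt 0 T f 0 0) : F = volterra 0 T E F' := by
  apply Lp.ext
  refine hF.trans ((h.eq_prim_of_hasValueAt hT ((integrable_of_Lp F).congr hF)
    ((integrable_of_Lp F').congr hF') h0).trans ?_)
  rw [← prim_congr hF']
  exact (coeFn_volterra F').symm

theorem HasValueAt.clm {E F : Type*} [NormedAddCommGroup E] [NormedSpace ℝ E]
    [NormedAddCommGroup F] [NormedSpace ℝ F] {a b x : ℝ} {f : ℝ → E} {c : E}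
    (h : HasValueAt a b f x c) (A : E →L[ℝ] F) : HasValueAt a b (fun t => A (f t)) x (A c) := by
  obtain ⟨G, h1, h2, h3⟩ := h
  refine ⟨fun t => A (G t), A.continuous.comp_continuousOn h1, ?_, congrArg A h3⟩
  filter_upwards [h2] with t ht
  rw [ht]

/-- A weak solution, as an equation for its second spatial derivative. -/
theorem IsWeakSolution.exists_secondDeriv (hℓ : 0 < ℓ) (hT : 0 < T) {ρ μ r κ : ℝ → ℝ}
    {g : Sobolev 2 0 T} (hρ : MemLp ρ ⊤ (muIoo 0 ℓ)) (hμ : MemLp μ ⊤ (muIoo 0 ℓ))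
    (hr : MemLp r ⊤ (muIoo 0 ℓ)) (hκ : MemLp κ ⊤ (muIoo 0 ℓ))
    (hg0 : HasValueAt 0 T (g.D 0) 0 0) (hg1 : HasValueAt 0 T (g.D 1) 0 0)
    {u : ℝ → ClampedH2 ℓ} (hu : IsWeakSolution ℓ T ρ μ r κ (g.D 0) 0 0 u) :
    ∃ w q : Lp (L2 0 ℓ) 2 (muIoo 0 T),
      (∀ᵐ t ∂(muIoo 0 T), (u t).D 0 = doubleVolterra ℓ (volterra 0 T (L2 0 ℓ) w t)) ∧
      (doubleVolterra ℓ).compLpL 2 (muIoo 0 T) w = volterra 0 T (L2 0 ℓ) q ∧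
      (doubleVolterra ℓ).adjoint.compLpL 2 (muIoo 0 T) ((mulOp hρ).compLpL 2 (muIoo 0 T) q)
        + (mulOp hκ + (doubleVolterra ℓ).adjoint ∘L mulOp hμ ∘L doubleVolterra ℓ).compLpL 2
          (muIoo 0 T) w
        + (mulOp hr).compLpL 2 (muIoo 0 T) (volterra 0 T (L2 0 ℓ) w)
        = volterra 0 T (L2 0 ℓ) (volterra 0 T (L2 0 ℓ)
          ((ContinuousLinearMap.toSpanSingleton ℝ (tipFunctional ℓ)).compLpL 2 (muIoo 0 T)
            (g.D 2))) := by
  obtain ⟨ut, utt, m0, m1, m2, d1, d2, heq, v0, v1⟩ := hu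
  set J := doubleVolterra ℓ with hJ
  have mh : MemLp (fun t => (u t).D 2) 2 (muIoo 0 T) := (ClampedH2.DL (ℓ := ℓ) 2).comp_memLp' m0
  have mw : MemLp (fun t => (ut t).D 2) 2 (muIoo 0 T) := (ClampedH2.DL (ℓ := ℓ) 2).comp_memLp' m1
  set h := mh.toLp _ with hh
  set w := mw.toLp _ with hw
  set q := m2.toLp _ with hq
  have eh : h =ᵐ[muIoo 0 T] fun t => (u t).D 2 := mh.coeFn_toLp
  have ew : w =ᵐ[muIoo 0 T] fun t => (ut t).D 2 := mw.coeFn_toLp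
  have eq : q =ᵐ[muIoo 0 T] utt := m2.coeFn_toLp
  have eJh : J.compLpL 2 (muIoo 0 T) h =ᵐ[muIoo 0 T] fun t => (u t).D 0 := by
    filter_upwards [J.coeFn_compLpL h, eh] with t h1 h2
    rw [h1, h2, (u t).D_zero_eq hℓ]
  have eJw : J.compLpL 2 (muIoo 0 T) w =ᵐ[muIoo 0 T] fun t => (ut t).D 0 := by
    filter_upwards [J.coeFn_compLpL w, ew] with t h1 h2
    rw [h1, h2, (ut t).D_zero_eq hℓ]
  have hJw : J.compLpL 2 (muIoo 0 T) w = volterra 0 T (L2 0 ℓ) q :=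
    eq_volterra_of_memLp hT eJw eq d2 v1
  -- The definition gives `u_t` as time derivative of `u` only in `L²(0, ℓ)`; injectivity of `J`
  -- carries this to second space derivatives.
  have hhw : h = volterra 0 T (L2 0 ℓ) w := by
    apply compLpL_injective (A := J) (μ := muIoo 0 T) doubleVolterra_injective
    rw [compLpL_volterra]
    refine eq_volterra_of_memLp hT eJh eJw d1 ?_
    exact v0.clm (ClampedH2.DL (ℓ := ℓ) 0)
  refine ⟨w, q, ?_, hJw, ?_⟩
  · rw [← hhw]
    filter_upwards [eJh, J.coeFn_compLpL h] with t h1 h2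
    rw [← h1, h2]
  set e := ContinuousLinearMap.toSpanSingleton ℝ (tipFunctional ℓ) with he
  have hg : volterra 0 T (L2 0 ℓ) (volterra 0 T (L2 0 ℓ) (e.compLpL 2 (muIoo 0 T) (g.D 2)))
      = e.compLpL 2 (muIoo 0 T) (g.D 0) := by
    have e1 : g.D 1 = volterra 0 T ℝ (g.D 2) :=
      eq_volterra_of_hasWeakDerivOn hT (g.hasWeakDerivOn 1) hg1
    have e0 : g.D 0 = volterra 0 T ℝ (g.D 1) :=
      eq_volterra_of_hasWeakDerivOn hT (g.hasWeakDerivOn 0) hg0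
    rw [← compLpL_volterra, ← compLpL_volterra, ← e1, ← e0]
  rw [hg, ← hhw]
  set N := mulOp hκ + J.adjoint ∘L mulOp hμ ∘L J with hN
  have key : ∀ᵐ t ∂(muIoo 0 T), J.adjoint (mulOp hρ (q t)) + N (w t) + mulOp hr (h t)
      - e (g.D 0 t) = 0 := by
    -- The exceptional null set depends on the test function. Separability of `L²`, which needs a
    -- finite exponent, supplies one null set for all of them.
    have : Fact ((2 : ENNReal) ≠ ⊤) := ⟨by norm_num⟩
    refine ae_eq_zero_of_forall_inner (𝕜 := ℝ) fun v => ?_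
    filter_upwards [heq (clampedOfSecondDeriv ℓ v) _ (hasValueAt_tip hℓ.le v), eh, ew, eq]
      with t h1 h2 h3 h4
    rw [D_zero_clampedOfSecondDeriv, D_two_clampedOfSecondDeriv, (ut t).D_zero_eq hℓ,
      ← inner_mulOp hρ, ← inner_mulOp hμ, ← inner_mulOp hr, ← inner_mulOp hκ, ← h2, ← h3, ← h4]
      at h1
    rw [real_inner_comm, inner_sub_left, inner_add_left, inner_add_left, hN,
      add_apply, inner_add_left, ContinuousLinearMap.comp_apply,
      ContinuousLinearMap.comp_apply, ContinuousLinearMap.adjoint_inner_left,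
      ContinuousLinearMap.adjoint_inner_left, he, ContinuousLinearMap.toSpanSingleton_apply,
      real_inner_smul_left]
    simp only [Pi.zero_apply]
    linarith
  apply Lp.ext
  filter_upwards [key,
    Lp.coeFn_add (J.adjoint.compLpL 2 (muIoo 0 T) ((mulOp hρ).compLpL 2 (muIoo 0 T) q)
      + N.compLpL 2 (muIoo 0 T) w) ((mulOp hr).compLpL 2 (muIoo 0 T) h),
    Lp.coeFn_add (J.adjoint.compLpL 2 (muIoo 0 T) ((mulOp hρ).compLpL 2 (muIoo 0 T) q))
      (N.compLpL 2 (muIoo 0 T) w), (mulOp hρ).coeFn_compLpL q,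
    J.adjoint.coeFn_compLpL ((mulOp hρ).compLpL 2 (muIoo 0 T) q), N.coeFn_compLpL w,
    (mulOp hr).coeFn_compLpL h, e.coeFn_compLpL (g.D 0)] with t t1 t2 t3 t4 t5 t6 t7 t8
  rw [t2, Pi.add_apply, t3, Pi.add_apply, t5, t4, t6, t7, t8, ← sub_eq_zero]
  exact t1

end Clamped

/-! ### `H²` as an algebra, and its multiplication operators -/

section Products

variable {a b : ℝ} {F G f g : ℝ → ℝ}

/-- `F` is a continuous function which on `[a, b]` is a primitive of the square integrable
function `f`. -/
structure IsPrim (a b : ℝ) (F f : ℝ → ℝ) : Prop where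
  cont : Continuous F
  memLp : MemLp f 2 (muIoo a b)
  eq : ∀ t ∈ Icc a b, F t = F a + prim a b f t

theorem IsPrim.integrable (h : IsPrim a b F f) : Integrable f (muIoo a b) :=
  h.memLp.integrable (by norm_num)

theorem MemLp.mul_continuous (hf : MemLp f 2 (muIoo a b)) (hG : Continuous G) :
    MemLp (fun t => f t * G t) 2 (muIoo a b) := by
  have h := memLp_mul (memLp_of_continuous (a := a) (b := b) hG ⊤) (hf.toLp f)
  refine h.ae_eq ?_
  filter_upwards [hf.coeFn_toLp] with t ht
  rw [ht, mul_comm]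

theorem IsPrim.add (hF : IsPrim a b F f) (hG : IsPrim a b G g) :
    IsPrim a b (fun t => F t + G t) (fun t => f t + g t) where
  cont := hF.cont.add hG.cont
  memLp := hF.memLp.add hG.memLp
  eq t ht := by
    rw [prim_add hF.integrable hG.integrable, hF.eq t ht, hG.eq t ht]; ring

theorem IsPrim.neg (hF : IsPrim a b F f) : IsPrim a b (fun t => -F t) (fun t => -f t) where
  cont := hF.cont.neg
  memLp := hF.memLp.neg
  eq t ht := by
    have h := prim_smul (a := a) (b := b) (-1) f t
    simp only [neg_smul, one_smul] at h
    rw [h, hF.eq t ht]; ring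

/-- The product formula for primitives, after splitting off the values of `F` and `G` at `a`. -/
theorem IsPrim.mul (hF : IsPrim a b F f) (hG : IsPrim a b G g) :
    IsPrim a b (fun t => F t * G t) (fun t => f t * G t + F t * g t) where
  cont := hF.cont.mul hG.cont
  memLp := by
    refine (MemLp.mul_continuous hF.memLp hG.cont).add ?_
    simp only [mul_comm (F _)]
    exact MemLp.mul_continuous hG.memLp hF.cont
  eq t ht := by
    have i1 : Integrable (fun s => f s * prim a b g s) (muIoo a b) :=
      (MemLp.mul_continuous hF.memLp (continuous_prim hG.integrable)).integrable (by norm_num)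
    have i2 : Integrable (fun s => prim a b f s * g s) (muIoo a b) := by
      simp only [mul_comm (prim a b f _)]
      exact (MemLp.mul_continuous hG.memLp (continuous_prim hF.integrable)).integrable (by norm_num)
    have i12 : Integrable (fun s => f s * prim a b g s + prim a b f s * g s) (muIoo a b) := i1.add i2
    have i3 : Integrable (fun s => G a • f s) (muIoo a b) := hF.integrable.const_mul _
    have i4 : Integrable (fun s => F a • g s) (muIoo a b) := hG.integrable.const_mul _
    have i34 : Integrable (fun s => G a • f s + F a • g s) (muIoo a b) := i3.add i4
    have e : (fun s => f s * G s + F s * g s) =ᵐ[muIoo a b]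
        fun s => (G a • f s + F a • g s) + (f s * prim a b g s + prim a b f s * g s) := by
      filter_upwards [ae_mem_Ioo a b] with s hs
      rw [hF.eq s (Ioo_subset_Icc_self hs), hG.eq s (Ioo_subset_Icc_self hs), smul_eq_mul,
        smul_eq_mul]
      ring
    rw [prim_congr e, prim_add i34 i12, prim_add i3 i4, prim_smul, prim_smul,
      ← prim_mul_prim hF.integrable hG.integrable ht.1, hF.eq t ht, hG.eq t ht, smul_eq_mul,
      smul_eq_mul]
    ring

theorem IsPrim.hasDerivAt (hF : IsPrim a b F f) (hf : Continuous f) {t : ℝ} (ht : t ∈ Ioo a b) :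
    HasDerivAt F (f t) t := by
  have h := ((hf.integral_hasStrictDerivAt a t).hasDerivAt).const_add (F a)
  refine h.congr_of_eventuallyEq ?_
  filter_upwards [Ioo_mem_nhds ht.1 ht.2] with s hs
  rw [hF.eq s (Ioo_subset_Icc_self hs), prim_eq_intervalIntegral (Ioo_subset_Icc_self hs)]

/-- As `f` is continuous, the derivative is classical. The lower bound holds only on `[a, b]`; the
maximum with `c` keeps the reciprocal continuous on the line. Writing the derivative as a product
lets `IsPrim.mul` differentiate it again. -/
theorem IsPrim.inv (hF : IsPrim a b F f) (hf : Continuous f) {c : ℝ} (hc : 0 < c)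
    (hFc : ∀ t ∈ Icc a b, c ≤ F t) :
    IsPrim a b (fun t => (max (F t) c)⁻¹)
      (fun t => -(f t * ((max (F t) c)⁻¹ * (max (F t) c)⁻¹))) := by
  have hpos : ∀ t, max (F t) c ≠ 0 := fun t => (hc.trans_le (le_max_right _ _)).ne'
  have hcont : Continuous fun t => (max (F t) c)⁻¹ := (hF.cont.max continuous_const).inv₀ hpos
  have hcont' : Continuous fun t => -(f t * ((max (F t) c)⁻¹ * (max (F t) c)⁻¹)) :=
    (hf.mul (hcont.mul hcont)).neg
  refine ⟨hcont, memLp_of_continuous hcont' 2, fun t ht => ?_⟩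
  rw [prim_eq_intervalIntegral ht, intervalIntegral.integral_eq_sub_of_hasDeriv_right_of_le ht.1
    hcont.continuousOn (fun x hx => ?_) (hcont'.intervalIntegrable _ _)]
  · ring
  · have hx' : x ∈ Ioo a b := ⟨hx.1, hx.2.trans_le ht.2⟩
    have hFx : F x ≠ 0 := (hc.trans_le (hFc x (Ioo_subset_Icc_self hx'))).ne'
    have h := (hF.hasDerivAt hf hx').inv hFx
    have h2 : HasDerivAt (fun t => (max (F t) c)⁻¹) (-f x / F x ^ 2) x := by
      refine h.congr_of_eventuallyEq ?_
      filter_upwards [Ioo_mem_nhds hx'.1 hx'.2] with s hs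
      rw [max_eq_left (hFc s (Ioo_subset_Icc_self hs))]; rfl
    rw [max_eq_left (hFc x (Ioo_subset_Icc_self hx'))]
    convert h2.hasDerivWithinAt using 1
    field_simp

/-- Continuous representatives of functions in `H²(a, b)`. -/
def IsH2 (a b : ℝ) (F : ℝ → ℝ) : Prop := ∃ F₁ f₂, IsPrim a b F F₁ ∧ IsPrim a b F₁ f₂

theorem IsH2.mul (hF : IsH2 a b F) (hG : IsH2 a b G) : IsH2 a b (fun t => F t * G t) := by
  obtain ⟨F₁, f₂, h1, h2⟩ := hF
  obtain ⟨G₁, g₂, k1, k2⟩ := hG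
  exact ⟨_, _, h1.mul k1, (h2.mul k1).add (h1.mul k2)⟩

theorem IsH2.inv (hF : IsH2 a b F) {c : ℝ} (hc : 0 < c) (hFc : ∀ t ∈ Icc a b, c ≤ F t) :
    IsH2 a b (fun t => (max (F t) c)⁻¹) := by
  obtain ⟨F₁, f₂, h1, h2⟩ := hF
  have k := h1.inv h2.cont hc hFc
  exact ⟨_, _, k, (h2.mul (k.mul k)).neg⟩

theorem IsPrim.hasWeakDerivOn (h : IsPrim a b F f) : HasWeakDerivOn a b F f := by
  refine (hasWeakDerivOn_add_prim h.integrable (F a)).congr ?_ (Filter.EventuallyEq.refl _ _)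
  filter_upwards [ae_mem_Ioo a b] with t ht
  rw [h.eq t (Ioo_subset_Icc_self ht)]

theorem IsH2.exists_sobolev (hF : IsH2 a b F) : ∃ S : Sobolev 2 a b, S.D 0 =ᵐ[muIoo a b] F := by
  obtain ⟨F₁, f₂, h1, h2⟩ := hF
  have m0 : MemLp F 2 (muIoo a b) := memLp_of_continuous h1.cont 2
  refine ⟨Sobolev.mk' ![m0.toLp F, h1.memLp.toLp F₁, h2.memLp.toLp f₂] fun i => ?_, m0.coeFn_toLp⟩
  fin_cases i
  · exact h1.hasWeakDerivOn.congr m0.coeFn_toLp.symm h1.memLp.coeFn_toLp.symm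
  · exact h2.hasWeakDerivOn.congr h1.memLp.coeFn_toLp.symm h2.memLp.coeFn_toLp.symm

theorem exists_isPrim (hab : a < b) {f f' : L2 a b} (h : HasWeakDerivOn a b f f') :
    ∃ F, f =ᵐ[muIoo a b] F ∧ IsPrim a b F f' := by
  obtain ⟨c, hc⟩ := h.exists_eq_add_prim hab (integrable_of_Lp f) (integrable_of_Lp f')
  refine ⟨_, hc, continuous_const.add (continuous_prim (integrable_of_Lp f')), Lp.memLp f', ?_⟩
  intro t _
  rw [prim_self, add_zero]

theorem IsPrim.congr (h : IsPrim a b F f) (hfg : f =ᵐ[muIoo a b] g) : IsPrim a b F g :=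
  ⟨h.cont, h.memLp.ae_eq hfg, fun t ht => by rw [h.eq t ht, prim_congr hfg]⟩

theorem Sobolev.exists_isH2 (hab : a < b) (S : Sobolev 2 a b) :
    ∃ F, S.D 0 =ᵐ[muIoo a b] F ∧ IsH2 a b F := by
  obtain ⟨F₁, h1, k1⟩ := exists_isPrim hab (S.hasWeakDerivOn 1)
  obtain ⟨F, h0, k0⟩ := exists_isPrim hab (S.hasWeakDerivOn 0)
  exact ⟨F, h0, F₁, _, k0.congr h1, k1⟩

theorem le_on_Icc_of_ae {c : ℝ} (hab : a < b) (hF : Continuous F)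
    (h : ∀ᵐ t ∂(muIoo a b), c ≤ F t) : ∀ t ∈ Icc a b, c ≤ F t := by
  have h1 : F =ᵐ[volume.restrict (Icc a b)] fun t => max (F t) c := by
    rw [← Measure.restrict_congr_set (Ioo_ae_eq_Icc (a := a) (b := b))]
    filter_upwards [h] with t ht
    rw [max_eq_left ht]
  intro t ht
  rw [Measure.eqOn_Icc_of_ae_eq volume hab.ne h1 hF.continuousOn
    (hF.max continuous_const).continuousOn ht]
  exact le_max_right _ _

/-- A bounded operator on `L²` which preserves `H^k` is bounded on `H^k`. -/
theorem exists_sobolev_operator {k : ℕ} (A : L2 a b →L[ℝ] L2 a b)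
    (hA : ∀ f : Sobolev k a b, ∃ m : Sobolev k a b, m.D 0 = A (f.D 0)) :
    ∃ B : Sobolev k a b →L[ℝ] Sobolev k a b, ∀ f, (B f).D 0 = A (f.D 0) := by
  choose B hB using hA
  have hι : Function.Injective (Sobolev.DL (k := k) (a := a) (b := b) 0) := fun _ _ h =>
    Sobolev.ext h
  let L : Sobolev k a b →ₗ[ℝ] Sobolev k a b :=
    { toFun := B
      map_add' := fun f g => hι (by
        simp only [map_add, Sobolev.DL_apply, hB]
        rw [← Sobolev.DL_apply, map_add, map_add]; rfl)
      map_smul' := fun c f => hι (by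
        simp only [map_smul, Sobolev.DL_apply, hB, RingHom.id_apply]
        rw [← Sobolev.DL_apply, map_smul, map_smul]; rfl) }
  -- Closed graph: convergence in `H^k` implies convergence in `L²`, where `A` is continuous, and
  -- the limit is determined by its underlying function.
  have hL : ∀ (u : ℕ → Sobolev k a b) (x y : Sobolev k a b),
      Filter.Tendsto u Filter.atTop (nhds x) → Filter.Tendsto (L ∘ u) Filter.atTop (nhds y) →
      y = L x := by
    intro u x y hx hy
    apply hι
    have h1 := ((Sobolev.DL (k := k) (a := a) (b := b) 0).continuous.tendsto y).comp hy
    have h2 := ((A ∘L Sobolev.DL (k := k) (a := a) (b := b) 0).continuous.tendsto x).comp hx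
    have e : (Sobolev.DL (k := k) (a := a) (b := b) 0) ∘ L ∘ u
        = (A ∘L Sobolev.DL (k := k) (a := a) (b := b) 0) ∘ u := funext fun n => hB (u n)
    rw [e] at h1
    exact (tendsto_nhds_unique h1 h2).trans (hB x).symm
  exact ⟨ContinuousLinearMap.ofSeqClosedGraph hL, hB⟩

theorem IsH2.exists_mul_operator (hab : a < b) {p : ℝ → ℝ} (hp : MemLp p ⊤ (muIoo a b))
    (hpF : p =ᵐ[muIoo a b] F) (hF : IsH2 a b F) :
    ∃ B : Sobolev 2 a b →L[ℝ] Sobolev 2 a b, ∀ f, (B f).D 0 = mulOp hp (f.D 0) := by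
  refine exists_sobolev_operator _ fun f => ?_
  obtain ⟨G, h1, h2⟩ := f.exists_isH2 hab
  obtain ⟨m, hm⟩ := (hF.mul h2).exists_sobolev
  refine ⟨m, Lp.ext ?_⟩
  filter_upwards [hm, h1, coeFn_mulOp hp (f.D 0), hpF] with t t1 t2 t3 t4
  rw [t1, t3, t2, t4]

end Products

/-! ### Space regularity through an ordinary differential equation in time -/

section SpaceRegularity

variable {ℓ T : ℝ}

/-- The adjoint of double integration, as an operator into `H²`. -/
def adjointDoubleVolterra (ℓ : ℝ) (hℓ : 0 ≤ ℓ) : L2 0 ℓ →L[ℝ] Sobolev 2 0 ℓ :=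
  Sobolev.lift (k := 2)
    ![(doubleVolterra ℓ).adjoint, -(volterra 0 ℓ ℝ).adjoint, ContinuousLinearMap.id ℝ (L2 0 ℓ)]
    (fun f i => by
      fin_cases i
      · have h := hasWeakDerivOn_adjoint_volterra hℓ ((volterra 0 ℓ ℝ).adjoint f)
        have e : (doubleVolterra ℓ).adjoint f
            = (volterra 0 ℓ ℝ).adjoint ((volterra 0 ℓ ℝ).adjoint f) := by
          rw [doubleVolterra, ContinuousLinearMap.adjoint_comp]; rfl
        rw [← e] at h
        exact h
      · have h := hasWeakDerivOn_adjoint_volterra hℓ (-f)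
        rw [neg_neg, map_neg] at h
        exact h)

theorem D_zero_adjointDoubleVolterra (hℓ : 0 ≤ ℓ) (f : L2 0 ℓ) :
    (adjointDoubleVolterra ℓ hℓ f).D 0 = (doubleVolterra ℓ).adjoint f := rfl

/-- The function `x ↦ ℓ - x` as an element of `H²`. -/
theorem exists_sobolev_tipFunctional (hℓ : 0 ≤ ℓ) :
    ∃ S : Sobolev 2 0 ℓ, S.D 0 = tipFunctional ℓ := by
  refine ⟨Sobolev.mk' ![tipFunctional ℓ, -oneL2 0 ℓ, 0] fun i => ?_, rfl⟩
  fin_cases i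
  · exact hasWeakDerivOn_adjoint_volterra hℓ (oneL2 0 ℓ)
  · refine (hasWeakDerivOn_const (a := 0) (b := ℓ) (-1 : ℝ)).congr ?_
      (Lp.coeFn_zero ℝ 2 (muIoo 0 ℓ)).symm
    change _ =ᵐ[muIoo 0 ℓ] ((-oneL2 0 ℓ : L2 0 ℓ) : ℝ → ℝ)
    filter_upwards [Lp.coeFn_neg (oneL2 0 ℓ), coeFn_oneL2 (a := 0) (b := ℓ)] with t h1 h2
    rw [h1, Pi.neg_apply, h2]

/-- Integrating twice, as an operator from `H²` to `H⁴`. -/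
def doubleVolterraSobolev (ℓ : ℝ) : Sobolev 2 0 ℓ →L[ℝ] Sobolev 4 0 ℓ :=
  Sobolev.lift (k := 4)
    ![doubleVolterra ℓ ∘L Sobolev.DL 0, volterra 0 ℓ ℝ ∘L Sobolev.DL 0, Sobolev.DL 0, Sobolev.DL 1,
      Sobolev.DL 2]
    (fun f i => by
      fin_cases i
      · exact hasWeakDerivOn_volterra (volterra 0 ℓ ℝ (f.D 0))
      · exact hasWeakDerivOn_volterra (f.D 0)
      · exact f.hasWeakDerivOn 0
      · exact f.hasWeakDerivOn 1)

theorem D_zero_doubleVolterraSobolev (f : Sobolev 2 0 ℓ) :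
    (doubleVolterraSobolev ℓ f).D 0 = doubleVolterra ℓ (f.D 0) := rfl

theorem compLpL_comp_apply {E F G : Type*} [NormedAddCommGroup E] [NormedSpace ℝ E]
    [NormedAddCommGroup F] [NormedSpace ℝ F] [NormedAddCommGroup G] [NormedSpace ℝ G]
    {μ : Measure ℝ} (A : F →L[ℝ] G) (B : E →L[ℝ] F) (f : Lp E 2 μ) :
    (A ∘L B).compLpL 2 μ f = A.compLpL 2 μ (B.compLpL 2 μ f) := by
  apply Lp.ext
  filter_upwards [(A ∘L B).coeFn_compLpL f, A.coeFn_compLpL (B.compLpL 2 μ f),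
    B.coeFn_compLpL f] with t h1 h2 h3
  rw [h1, h2, h3, ContinuousLinearMap.comp_apply]

/-- If `κ h' + r h` takes values in a space `X` that is preserved by the operators `κ⁻¹` and
`r`, then so do `h` and `h'`. -/
theorem exists_lift_of_ode {E X : Type*} [NormedAddCommGroup E] [NormedSpace ℝ E] [CompleteSpace E]
    [NormedAddCommGroup X] [NormedSpace ℝ X] [CompleteSpace X] (hT : 0 ≤ T) (ι : X →L[ℝ] E)
    {κ' r : E →L[ℝ] E} {Bκ Br : X →L[ℝ] X} (hκ : ∀ x, ι (Bκ x) = κ' (ι x))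
    (hr : ∀ x, ι (Br x) = r (ι x)) {w : Lp E 2 (muIoo 0 T)} {m : Lp X 2 (muIoo 0 T)}
    (hw : w = κ'.compLpL 2 (muIoo 0 T) (ι.compLpL 2 (muIoo 0 T) m
      - r.compLpL 2 (muIoo 0 T) (volterra 0 T E w))) :
    ∃ x y : Lp X 2 (muIoo 0 T), ι.compLpL 2 (muIoo 0 T) x = w ∧
      ι.compLpL 2 (muIoo 0 T) y = volterra 0 T E w := by
  have lκ : ∀ f : Lp X 2 (muIoo 0 T), ι.compLpL 2 (muIoo 0 T) (Bκ.compLpL 2 (muIoo 0 T) f) = κ'.compLpL 2 (muIoo 0 T) (ι.compLpL 2 (muIoo 0 T) f) := by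
    intro f
    rw [← compLpL_comp_apply, ← compLpL_comp_apply]
    congr 2
    exact ContinuousLinearMap.ext hκ
  have lr : ∀ f : Lp X 2 (muIoo 0 T), ι.compLpL 2 (muIoo 0 T) (Br.compLpL 2 (muIoo 0 T) f) = r.compLpL 2 (muIoo 0 T) (ι.compLpL 2 (muIoo 0 T) f) := by
    intro f
    rw [← compLpL_comp_apply, ← compLpL_comp_apply]
    congr 2
    exact ContinuousLinearMap.ext hr
  have uX := isUnit_one_sub_volterra_mul (E := X) hT (A := -(Bκ ∘L Br).compLpL 2 (muIoo 0 T))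
    (Commute.neg_right (ContinuousLinearMap.ext fun f => (compLpL_volterra (Bκ ∘L Br) f).symm))
  have uE := isUnit_one_sub_volterra_mul (E := E) hT (A := -(κ' ∘L r).compLpL 2 (muIoo 0 T))
    (Commute.neg_right (ContinuousLinearMap.ext fun f => (compLpL_volterra (κ' ∘L r) f).symm))
  -- The integrated equation `y = V (κ⁻¹ (m - r y))`, solved among `X`-valued functions.
  obtain ⟨y, hy⟩ : ∃ y, y + volterra 0 T X ((Bκ ∘L Br).compLpL 2 (muIoo 0 T) y)
      = volterra 0 T X (Bκ.compLpL 2 (muIoo 0 T) m) := by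
    obtain ⟨U, hU⟩ := uX
    refine ⟨(↑U⁻¹ : Lp X 2 (muIoo 0 T) →L[ℝ] Lp X 2 (muIoo 0 T)) (volterra 0 T X (Bκ.compLpL 2 (muIoo 0 T) m)), ?_⟩
    have h := congrArg (fun L : Lp X 2 (muIoo 0 T) →L[ℝ] Lp X 2 (muIoo 0 T) => L (volterra 0 T X (Bκ.compLpL 2 (muIoo 0 T) m)))
      U.mul_inv
    rw [hU] at h
    simpa [mul_apply_eq_comp, sub_neg_eq_add] using h
  have hιy : ι.compLpL 2 (muIoo 0 T) y = volterra 0 T E w := by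
    have h1 : ι.compLpL 2 (muIoo 0 T) y + volterra 0 T E ((κ' ∘L r).compLpL 2 (muIoo 0 T) (ι.compLpL 2 (muIoo 0 T) y))
        = volterra 0 T E (κ'.compLpL 2 (muIoo 0 T) (ι.compLpL 2 (muIoo 0 T) m)) := by
      rw [compLpL_comp_apply, ← lr, ← lκ, ← lκ, ← compLpL_volterra ι, ← compLpL_volterra ι,
        ← compLpL_comp_apply Bκ, ← map_add, hy]
    have h2 : volterra 0 T E w + volterra 0 T E ((κ' ∘L r).compLpL 2 (muIoo 0 T) (volterra 0 T E w))
        = volterra 0 T E (κ'.compLpL 2 (muIoo 0 T) (ι.compLpL 2 (muIoo 0 T) m)) := by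
      rw [← map_add]
      congr 1
      conv_lhs => enter [1]; rw [hw]
      rw [map_sub, compLpL_comp_apply, sub_add_cancel]
    obtain ⟨U, hU⟩ := uE
    have hinj : Function.Injective (1 - volterra 0 T E * -(κ' ∘L r).compLpL 2 (muIoo 0 T) :
        Lp E 2 (muIoo 0 T) →L[ℝ] Lp E 2 (muIoo 0 T)) := by
      rw [← hU]
      refine Function.LeftInverse.injective
        (g := ((↑U⁻¹ : Lp E 2 (muIoo 0 T) →L[ℝ] Lp E 2 (muIoo 0 T)) : Lp E 2 (muIoo 0 T) → Lp E 2 (muIoo 0 T))) fun f => ?_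
      exact congrArg (fun L : Lp E 2 (muIoo 0 T) →L[ℝ] Lp E 2 (muIoo 0 T) => L f) U.inv_mul
    -- Both `ι y` and `V w` solve the same Volterra equation with values in `E`, whose solution is
    -- unique.
    apply hinj
    have e : ∀ f, (1 - volterra 0 T E * -(κ' ∘L r).compLpL 2 (muIoo 0 T) : Lp E 2 (muIoo 0 T) →L[ℝ] Lp E 2 (muIoo 0 T)) f
        = f + volterra 0 T E ((κ' ∘L r).compLpL 2 (muIoo 0 T) f) := by
      intro f
      simp [mul_apply_eq_comp]
    rw [e, e, h1, h2]
  refine ⟨Bκ.compLpL 2 (muIoo 0 T) (m - Br.compLpL 2 (muIoo 0 T) y), y, ?_, hιy⟩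
  rw [lκ, map_sub, lr, hιy]
  exact hw.symm

end SpaceRegularity

/-- With `c = ℓ³ / 3` one has `ℓ³ + 3 = 3 (c + 1)`; the two entries of the maximum are the
coefficients produced by the energy estimate. -/
theorem C5sq_eq {ℓ T r₁ κ₀ : ℝ} (hκ₀ : 0 < κ₀) (hℓ : 0 < ℓ) :
    C5sq ℓ T r₁ κ₀ = max (4 * (ℓ ^ 3 / 3 + 1) * (1 + T) / κ₀ ^ 2)
      (4 / κ₀ * (κ₀ * (ℓ ^ 3 / 3) / (4 * (ℓ ^ 3 / 3 + 1)) + r₁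
        + T * r₁ ^ 2 * (ℓ ^ 3 / 3 + 1) / κ₀)) := by
  have h1 : (0 : ℝ) < ℓ ^ 3 + 3 := by positivity
  have h2 : (0 : ℝ) < ℓ ^ 3 / 3 + 1 := by positivity
  rw [C5sq, mul_max_of_nonneg _ _ (by positivity)]
  congr 1
  · field_simp
    ring
  · field_simp
    ring

end

/-! ### The regularity theorem -/

theorem theorem2p2 (ℓ T : ℝ) (hℓ : 0 < ℓ) (hT : 0 < T)
    (ρ₀ ρ₁ μ₀ μ₁ r₀ r₁ κ₀ κ₁ : ℝ)
    (hρ₀ : 0 < ρ₀) (hμ₀ : 0 ≤ μ₀) (hr₀ : 0 < r₀) (hκ₀ : 0 < κ₀)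
    (ρ μ : ℝ → ℝ) (hρ : MemLp ρ ⊤ (muIoo 0 ℓ)) (hμ : MemLp μ ⊤ (muIoo 0 ℓ))
    (r κ : Sobolev 2 0 ℓ) (g : Sobolev 2 0 T)
    (hρ_bd : ∀ᵐ x ∂(muIoo 0 ℓ), ρ₀ ≤ ρ x ∧ ρ x ≤ ρ₁)
    (hμ_bd : ∀ᵐ x ∂(muIoo 0 ℓ), μ₀ ≤ μ x ∧ μ x ≤ μ₁)
    (hr_bd : ∀ᵐ x ∂(muIoo 0 ℓ), r₀ ≤ r.D 0 x ∧ r.D 0 x ≤ r₁)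
    (hκ_bd : ∀ᵐ x ∂(muIoo 0 ℓ), κ₀ ≤ κ.D 0 x ∧ κ.D 0 x ≤ κ₁)
    (hg0 : HasValueAt 0 T (g.D 0) 0 0) (hg1 : HasValueAt 0 T (g.D 1) 0 0)
    (u : ℝ → ClampedH2 ℓ)
    (hu : IsWeakSolution ℓ T ρ μ (r.D 0) (κ.D 0) (g.D 0) 0 0 u) :
    ∃ ut utt uttt : ℝ → L2 0 ℓ,
      HasWeakDerivOn 0 T (fun t => (u t).D 0) ut ∧
      HasWeakDerivOn 0 T ut utt ∧
      HasWeakDerivOn 0 T utt uttt ∧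
      MemL2Sobolev 4 ℓ T (fun t => (u t).D 0) ∧
      MemL2Sobolev 4 ℓ T ut ∧
      MemL2Clamped ℓ T utt ∧
      MemLp uttt 2 (muIoo 0 T) ∧
      ∫ t in Ioo 0 T, ‖uttt t‖ ^ 2
        ≤ κ₀ / 2 * (C5sq ℓ T r₁ κ₀ / (2 * ρ₀)) * Real.exp (C5sq ℓ T r₁ κ₀ * T) * ‖g‖ ^ 2 := by
  have hr : MemLp (r.D 0) ⊤ (muIoo 0 ℓ) := memLp_top_of_bound (Lp.memLp (r.D 0)).1 r₁ (by
    filter_upwards [hr_bd] with x hx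
    rw [Real.norm_eq_abs, abs_of_nonneg (hr₀.le.trans hx.1)]
    exact hx.2)
  have hκ : MemLp (κ.D 0) ⊤ (muIoo 0 ℓ) := memLp_top_of_bound (Lp.memLp (κ.D 0)).1 κ₁ (by
    filter_upwards [hκ_bd] with x hx
    rw [Real.norm_eq_abs, abs_of_nonneg (hκ₀.le.trans hx.1)]
    exact hx.2)
  have hr₁ : 0 ≤ r₁ := by
    -- The interval has positive measure, so the almost everywhere bounds hold at some point.
    have : (muIoo 0 ℓ) ≠ 0 := by
      rw [muIoo, Ne, Measure.restrict_eq_zero, Real.volume_Ioo]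
      simpa using hℓ
    have : (ae (muIoo 0 ℓ)).NeBot := ae_neBot.2 this
    obtain ⟨x, hx⟩ := hr_bd.exists
    exact hr₀.le.trans (hx.1.trans hx.2)
  obtain ⟨w, q, huw, hwq, heq⟩ := hu.exists_secondDeriv hℓ hT hρ hμ hr hκ hg0 hg1
  set J := doubleVolterra ℓ with hJ
  set V := volterra 0 T (L2 0 ℓ) with hV
  set e := ContinuousLinearMap.toSpanSingleton ℝ (tipFunctional ℓ) with he
  set N := mulOp hκ + J.adjoint ∘L mulOp hμ ∘L J with hN
  have hNsymm : ∀ x y, inner ℝ (N x) y = inner ℝ x (N y) := by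
    intro x y
    simp only [hN, add_apply, inner_add_left, inner_add_right, ContinuousLinearMap.comp_apply,
      ContinuousLinearMap.adjoint_inner_left, ContinuousLinearMap.adjoint_inner_right, mulOp_symm]
  have hN0 : ∀ x, κ₀ * ‖x‖ ^ 2 ≤ inner ℝ (N x) x := by
    intro x
    have h1 := mul_norm_sq_le_inner_mulOp hκ (hκ_bd.mono fun x hx => hx.1) x
    have h2 := mul_norm_sq_le_inner_mulOp hμ (hμ_bd.mono fun x hx => hx.1) (J x)
    have h3 : 0 ≤ μ₀ * ‖J x‖ ^ 2 := by positivity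
    simp only [hN, add_apply, inner_add_left, ContinuousLinearMap.comp_apply,
      ContinuousLinearMap.adjoint_inner_left]
    linarith
  have hf : ‖e.compLpL 2 (muIoo 0 T) (g.D 2)‖ ^ 2 ≤ ℓ ^ 3 / 3 * ‖g‖ ^ 2 := by
    -- The norm of `e` is that of `ℓ - x`, and `g''` is bounded by the full `H²` norm of `g`.
    have h1 : ‖e‖ ^ 2 = ℓ ^ 3 / 3 := by
      rw [he, ContinuousLinearMap.norm_toSpanSingleton, tipFunctional,
        norm_sq_adjoint_volterra_one hℓ.le, sub_zero]
    rw [← h1, ← mul_pow]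
    gcongr
    refine ((e.compLpL 2 (muIoo 0 T)).le_opNorm _).trans ?_
    exact mul_le_mul (ContinuousLinearMap.norm_compLpL_le e) (g.norm_D_le 2) (norm_nonneg _)
      (norm_nonneg _)
  have hC := C5sq_eq (T := T) (r₁ := r₁) hκ₀ hℓ
  obtain ⟨z, q', hz, hzq, hq', hbound⟩ := exists_time_derivatives hT.le hρ₀ hκ₀
    (c := ℓ ^ 3 / 3) (Γ := ‖g‖ ^ 2) (C := C5sq ℓ T r₁ κ₀) (r₁ := r₁) (by positivity)
    (mulOp_symm hρ) (mul_norm_sq_le_inner_mulOp hρ (hρ_bd.mono fun x hx => hx.1)) hNsymm hN0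
    (mulOp_symm hr) (fun x => le_trans (by positivity)
      (mul_norm_sq_le_inner_mulOp hr (hr_bd.mono fun x hx => hx.1) x))
    (norm_mulOp_le hr hr₁ (hr_bd.mono fun x hx => by
      rw [abs_of_nonneg (hr₀.le.trans hx.1)]; exact hx.2))
    (by rw [hC]; exact le_max_left _ _) (by rw [hC]; exact le_max_right _ _) hf hwq heq
  obtain ⟨R, hRr, hR⟩ := r.exists_isH2 hℓ
  obtain ⟨Br, hBr⟩ := hR.exists_mul_operator hℓ hr hRr
  obtain ⟨K, hKκ, hK⟩ := κ.exists_isH2 hℓ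
  have hKκ₀ : ∀ x ∈ Icc 0 ℓ, κ₀ ≤ K x := by
    obtain ⟨K₁, _, hK1, _⟩ := id hK
    refine le_on_Icc_of_ae hℓ hK1.cont ?_
    filter_upwards [hκ_bd, hKκ] with x h1 h2
    rw [← h2]
    exact h1.1
  have hKinv := hK.inv hκ₀ hKκ₀
  -- The truncation at `κ₀` is inactive on the interval, so this is `κ⁻¹` almost everywhere.
  have hκ' : MemLp (fun x => (max (K x) κ₀)⁻¹) ⊤ (muIoo 0 ℓ) := by
    obtain ⟨_, _, h1, _⟩ := id hKinv
    exact memLp_of_continuous h1.cont ⊤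
  obtain ⟨Bκ, hBκ⟩ := hKinv.exists_mul_operator hℓ hκ' (Filter.EventuallyEq.refl _ _)
  obtain ⟨eS, heS⟩ := exists_sobolev_tipFunctional hℓ.le
  set ι := Sobolev.DL (k := 2) (a := 0) (b := ℓ) 0 with hι
  -- The function `g (ℓ - x) - J* (ρ u_tt + μ u_t)` with values in `H²`; by the equation it equals
  -- `κ w + r V w`.
  set m : Lp (Sobolev 2 0 ℓ) 2 (muIoo 0 T) :=
    (ContinuousLinearMap.toSpanSingleton ℝ eS).compLpL 2 (muIoo 0 T)
        (volterra 0 T ℝ (volterra 0 T ℝ (g.D 2)))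
      - (adjointDoubleVolterra ℓ hℓ.le).compLpL 2 (muIoo 0 T)
        ((mulOp hρ).compLpL 2 (muIoo 0 T) q
          + (mulOp hμ).compLpL 2 (muIoo 0 T) (J.compLpL 2 (muIoo 0 T) w)) with hm
  have hιm : ι.compLpL 2 (muIoo 0 T) m - (mulOp hr).compLpL 2 (muIoo 0 T) (V w)
      = (mulOp hκ).compLpL 2 (muIoo 0 T) w := by
    have e1 : ι ∘L ContinuousLinearMap.toSpanSingleton ℝ eS = e := by
      ext1
      simp [hι, he, heS]
    have e2 : ι ∘L adjointDoubleVolterra ℓ hℓ.le = J.adjoint := by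
      ext1 x
      exact D_zero_adjointDoubleVolterra hℓ.le x
    rw [hm, map_sub, ← compLpL_comp_apply, ← compLpL_comp_apply, e1, e2, map_add,
      compLpL_volterra, compLpL_volterra, ← hV, ← heq, hN, ContinuousLinearMap.add_compLpL,
      add_apply, compLpL_comp_apply, compLpL_comp_apply]
    abel
  have hw : w = (mulOp hκ').compLpL 2 (muIoo 0 T) (ι.compLpL 2 (muIoo 0 T) m
      - (mulOp hr).compLpL 2 (muIoo 0 T) (V w)) := by
    rw [hιm, ← compLpL_comp_apply]
    have e1 : mulOp hκ' ∘L mulOp hκ = ContinuousLinearMap.id ℝ (L2 0 ℓ) := by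
      ext1 f
      refine mulOp_comp_of_mul_eq_one hκ' hκ ?_ f
      filter_upwards [hκ_bd, hKκ] with x h1 h2
      rw [← h2, max_eq_left h1.1, inv_mul_cancel₀ (hκ₀.trans_le h1.1).ne']
    rw [e1]
    exact (Lp.ext (ContinuousLinearMap.coeFn_compLpL _ _)).symm
  obtain ⟨x, y, hx, hy⟩ := exists_lift_of_ode hT.le ι (fun f => hBκ f) (fun f => hBr f) hw
  have huVw : (fun t => (u t).D 0) =ᵐ[muIoo 0 T] V (J.compLpL 2 (muIoo 0 T) w) := by
    rw [← compLpL_volterra]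
    filter_upwards [huw, J.coeFn_compLpL (V w)] with t h1 h2
    rw [h1, h2]
  refine ⟨J.compLpL 2 (muIoo 0 T) w, q, q', ?_, ?_, ?_, ?_, ?_, ?_, Lp.memLp q', ?_⟩
  · exact (hasWeakDerivOn_prim (integrable_of_Lp _)).congr
      ((coeFn_volterra _).symm.trans huVw.symm) (Filter.EventuallyEq.refl _ _)
  · rw [hwq]
    exact (hasWeakDerivOn_prim (integrable_of_Lp _)).congr (coeFn_volterra q).symm
      (Filter.EventuallyEq.refl _ _)
  · rw [← hq']
    exact (hasWeakDerivOn_prim (integrable_of_Lp _)).congr (coeFn_volterra q').symm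
      (Filter.EventuallyEq.refl _ _)
  · refine ⟨(doubleVolterraSobolev ℓ).compLpL 2 (muIoo 0 T) y, Lp.memLp _, ?_⟩
    filter_upwards [(doubleVolterraSobolev ℓ).coeFn_compLpL y, ι.coeFn_compLpL y, huw]
      with t h1 h2 h3
    rw [h1, h3, D_zero_doubleVolterraSobolev, ← hJ, ← hy, h2]
    rfl
  · refine ⟨(doubleVolterraSobolev ℓ).compLpL 2 (muIoo 0 T) x, Lp.memLp _, ?_⟩
    filter_upwards [(doubleVolterraSobolev ℓ).coeFn_compLpL x, ι.coeFn_compLpL x,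
      J.coeFn_compLpL w] with t h1 h2 h3
    rw [h1, h3, D_zero_doubleVolterraSobolev, ← hJ, ← hx, h2]
    rfl
  · refine ⟨(clampedOfSecondDeriv ℓ).compLpL 2 (muIoo 0 T) z, Lp.memLp _, ?_⟩
    filter_upwards [(clampedOfSecondDeriv ℓ).coeFn_compLpL z, J.coeFn_compLpL z] with t h1 h2
    rw [h1, D_zero_clampedOfSecondDeriv, ← hJ, ← h2, hzq]
  · rw [← norm_sq_eq_integral]
    exact hbound
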